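/- Work in second order arithmetic, the first order theory in the two-sorted language $L_2$ with number variables, set variables, $0,1,+,\cdot,<,\in$. $\mathsf{RCA}_0$ consists of the basic axioms for $0,1,+,\cdot,<$, together with $\Sigma^0_1$ induction and $\Delta^0_1$ comprehension (both with number and set parameters), and $\mathsf{WKL}_0$ is $\mathsf{RCA}_0$ plus weak König's lemma: every infinite tree $T\subseteq 2^{<\mathbb N}$ has a path. All notions below are read inside second order arithmetic, with pairs and finite sequences coded by numbers. A partial order $(P,\preceq_P)$ consists of sets $P\subseteq\mathbb N$ and ${\preceq_P}\subseteq P\times P$ with $\preceq_P$ reflexive, antisymmetric and transitive on $P$; an initial interval of $P$ is a set $I\subseteq P$ such that $x\preceq_P y$ and $y\in I$ imply $x\in I$ for all $x,y\in P$; $\mathrm{Int}(P)$ denotes the collection of initial intervals of $P$; an embedding of $Q$ into $P$ is a function $f\colon Q\to P$ such that $x\preceq_Q y\iff f(x)\preceq_P f(y)$ for all $x,y\in Q$. **Lemma.** Over $\mathsf{RCA}_0$ (that is, in every model of $\mathsf{RCA}_0$, including those with nonstandard numbers) the following are equivalent: 1. $\mathsf{WKL}_0$; 2. if $Q$ and $P$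 are partial orders and $f$ is an embedding of $Q$ into $P$, then $\mathrm{Int}(Q)=\{f^{-1}(J) : J\in\mathrm{Int}(P)\}$; 3. if $Q$ is a subset of a partial order $P$, with the induced order, then $\mathrm{Int}(Q)=\{J\cap Q : J\in\mathrm{Int}(P)\}$. -/

import Mathlib

/-! Second order arithmetic, its subsystems RCA₀ and WKL₀, and countable partial orders in them.
Everything is read inside an arbitrary (possibly nonstandard) structure for the language `L₂`:
all quantifiers range over the numbers or over the designated sets of that structure. -/

universe u

/-- A structure for the language `L₂` of second order arithmetic: a set `N` of numbers with
`0, 1, +, ·, <`, and a nonempty collection `S` of subsets of `N` over which the set variables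
range. Nothing is assumed about the operations. -/
structure L2Structure : Type (u + 1) where
  N : Type u
  S : Set (Set N)
  S_nonempty : S.Nonempty
  zero : N
  one : N
  add : N → N → N
  mul : N → N → N
  lt : N → N → Prop

/-- Numerical terms of `L₂`. Number variables are de Bruijn indices. -/
inductive NumTerm : Type
  | var (k : ℕ) : NumTerm
  | zero : NumTerm
  | one : NumTerm
  | add (s t : NumTerm) : NumTerm
  | mul (s t : NumTerm) : NumTerm

/-- The bounded quantifier (`Σ⁰₀`) formulas of `L₂`: built from the atomic formulas `s = t`,
`s < t`, `t ∈ X` by propositional connectives and the quantifiers `∀ n < t`, `∃ n < t`, where the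
bound variable does not occur in `t`. A bounded quantifier binds number variable `0` of its body
and shifts the other number variables by one; its bound `t` is read outside the scope. Set
variables are never bound, they are named by natural numbers. -/
inductive BddFormula : Type
  | eq (s t : NumTerm) : BddFormula
  | lt (s t : NumTerm) : BddFormula
  | mem (t : NumTerm) (X : ℕ) : BddFormula
  | neg (φ : BddFormula) : BddFormula
  | and (φ ψ : BddFormula) : BddFormula
  | or (φ ψ : BddFormula) : BddFormula
  | imp (φ ψ : BddFormula) : BddFormula
  | ball (t : NumTerm) (φ : BddFormula) : BddFormula
  | bex (t : NumTerm) (φ : BddFormula) : BddFormula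

namespace L2Structure

instance (M : L2Structure.{u}) : Zero M.N := ⟨M.zero⟩
instance (M : L2Structure.{u}) : One M.N := ⟨M.one⟩
instance (M : L2Structure.{u}) : Add M.N := ⟨M.add⟩
instance (M : L2Structure.{u}) : Mul M.N := ⟨M.mul⟩
instance (M : L2Structure.{u}) : LT M.N := ⟨M.lt⟩

/-- The assignment with value `a` at variable `0` and value `e k` at variable `k + 1`. -/
def push (M : L2Structure.{u}) (a : M.N) (e : ℕ → M.N) : ℕ → M.N
  | 0 => a
  | k + 1 => e k

/-- Value of a term under an assignment of the number variables. -/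
def eval (M : L2Structure.{u}) (e : ℕ → M.N) : NumTerm → M.N
  | .var k => e k
  | .zero => 0
  | .one => 1
  | .add s t => M.eval e s + M.eval e t
  | .mul s t => M.eval e s * M.eval e t

/-- Truth of a bounded quantifier formula under an assignment `e` of the number variables and an
assignment `E` of the set variables. -/
def Holds (M : L2Structure.{u}) (E : ℕ → Set M.N) : (ℕ → M.N) → BddFormula → Prop
  | e, .eq s t => M.eval e s = M.eval e t
  | e, .lt s t => M.eval e s < M.eval e t
  | e, .mem t X => M.eval e t ∈ E X
  | e, .neg φ => ¬ M.Holds E e φ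
  | e, .and φ ψ => M.Holds E e φ ∧ M.Holds E e ψ
  | e, .or φ ψ => M.Holds E e φ ∨ M.Holds E e ψ
  | e, .imp φ ψ => M.Holds E e φ → M.Holds E e ψ
  | e, .ball t φ => ∀ a : M.N, a < M.eval e t → M.Holds E (M.push a e) φ
  | e, .bex t φ => ∃ a : M.N, a < M.eval e t ∧ M.Holds E (M.push a e) φ

/-- The `Σ⁰₁` formula `∃ m θ(m, n)` at `n`: in `θ`, variable `0` is `m`, variable `1` is `n`, and
the remaining number variables and the set variables are parameters, given by `e` and `E`. -/
def Sigma1 (M : L2Structure.{u}) (E : ℕ → Set M.N) (e : ℕ → M.N) (θ : BddFormula)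
    (n : M.N) : Prop :=
  ∃ m : M.N, M.Holds E (M.push m (M.push n e)) θ

/-- The `Π⁰₁` formula `∀ m θ(m, n)` at `n`, with the same conventions. -/
def Pi1 (M : L2Structure.{u}) (E : ℕ → Set M.N) (e : ℕ → M.N) (θ : BddFormula)
    (n : M.N) : Prop :=
  ∀ m : M.N, M.Holds E (M.push m (M.push n e)) θ

/-- `M` is a model of RCA₀: the basic axioms, the `Σ⁰₁` induction scheme and the `Δ⁰₁`
comprehension scheme, the schemes with arbitrary number and set parameters from `M`. -/
structure ModelsRCA0 (M : L2Structure.{u}) : Prop where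
  succ_ne_zero : ∀ n : M.N, n + 1 ≠ 0
  succ_inj : ∀ m n : M.N, m + 1 = n + 1 → m = n
  add_zero : ∀ m : M.N, m + 0 = m
  add_succ : ∀ m n : M.N, m + (n + 1) = (m + n) + 1
  mul_zero : ∀ m : M.N, m * 0 = 0
  mul_succ : ∀ m n : M.N, m * (n + 1) = m * n + m
  not_lt_zero : ∀ m : M.N, ¬ m < 0
  lt_succ : ∀ m n : M.N, m < n + 1 ↔ m < n ∨ m = n
  sigma1_induction : ∀ (θ : BddFormula) (e : ℕ → M.N) (E : ℕ → Set M.N), (∀ k, E k ∈ M.S) →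
    M.Sigma1 E e θ 0 → (∀ n, M.Sigma1 E e θ n → M.Sigma1 E e θ (n + 1)) →
    ∀ n, M.Sigma1 E e θ n
  delta1_comprehension : ∀ (θ η : BddFormula) (e : ℕ → M.N) (E : ℕ → Set M.N),
    (∀ k, E k ∈ M.S) → (∀ n, M.Sigma1 E e θ n ↔ M.Pi1 E e η n) →
    {n | M.Sigma1 E e θ n} ∈ M.S

/-! ### Pairs, functions, finite sequences -/

/-- The code `(i + j)² + i` of the ordered pair `(i, j)`. -/
def pair (M : L2Structure.{u}) (i j : M.N) : M.N := (i + j) * (i + j) + i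

/-- The set `X × Y` of codes of pairs. -/
def prod (M : L2Structure.{u}) (X Y : Set M.N) : Set M.N :=
  {n | ∃ i ∈ X, ∃ j ∈ Y, n = M.pair i j}

/-- `f` is (the graph of) a function from `X` to `Y`. -/
def IsFunction (M : L2Structure.{u}) (f X Y : Set M.N) : Prop :=
  f ∈ M.S ∧ f ⊆ M.prod X Y ∧ ∀ i ∈ X, ∃! j : M.N, M.pair i j ∈ f

/-- The number `c = (k, (m, n))` determines the finite set of all `i < k` such that
`m(i + 1) + 1` divides `n`; this is that set. -/
def finSet (M : L2Structure.{u}) (c : M.N) : Set M.N :=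
  {i | ∃ k m n : M.N, c = M.pair k (M.pair m n) ∧ i < k ∧
    ∃ q : M.N, n = (m * (i + 1) + 1) * q}

/-- `c` is the code of a finite set: the least number of the form `(k, (m, n))` that determines
the set it determines. -/
def IsFinCode (M : L2Structure.{u}) (c : M.N) : Prop :=
  (∃ k m n : M.N, c = M.pair k (M.pair m n)) ∧
  ∀ d : M.N, d < c → (∃ k m n : M.N, d = M.pair k (M.pair m n)) → M.finSet d ≠ M.finSet c

/-- `s` is the code of a finite sequence of length `l`; a finite sequence is the finite set of
the pairs `(i, s(i))`, `i < l`. -/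
def IsSeq (M : L2Structure.{u}) (l s : M.N) : Prop :=
  M.IsFinCode s ∧
  (∀ n ∈ M.finSet s, ∃ i j : M.N, n = M.pair i j) ∧
  (∀ i j j' : M.N, M.pair i j ∈ M.finSet s → M.pair i j' ∈ M.finSet s → j = j') ∧
  ∀ i : M.N, i < l ↔ ∃ j : M.N, M.pair i j ∈ M.finSet s

/-- `s` is the code of a finite sequence of zeros and ones, that is, `s ∈ 2^{<ℕ}`. -/
def IsBinSeq (M : L2Structure.{u}) (s : M.N) : Prop :=
  (∃ l : M.N, M.IsSeq l s) ∧ ∀ i j : M.N, M.pair i j ∈ M.finSet s → j = 0 ∨ j = 1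

/-- The sequence coded by `s` is an initial segment of the sequence coded by `t`
(for finite sequences this is inclusion of their graphs). -/
def IsInitSeg (M : L2Structure.{u}) (s t : M.N) : Prop :=
  M.finSet s ⊆ M.finSet t

/-- `T` is a subtree of `2^{<ℕ}`. -/
def IsBinTree (M : L2Structure.{u}) (T : Set M.N) : Prop :=
  T ∈ M.S ∧ (∀ t ∈ T, M.IsBinSeq t) ∧
  ∀ t ∈ T, ∀ s : M.N, M.IsBinSeq s → M.IsInitSeg s t → s ∈ T

/-- A set is infinite if it is unbounded in the numbers. -/
def IsInfinite (M : L2Structure.{u}) (X : Set M.N) : Prop :=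
  ∀ k : M.N, ∃ n ∈ X, k < n

/-- `f` is a path in `T`: a function on the numbers such that for every `n` the finite sequence
`f ↾ n` (of length `n`) belongs to `T`. -/
def IsPath (M : L2Structure.{u}) (f T : Set M.N) : Prop :=
  M.IsFunction f Set.univ Set.univ ∧
  ∀ n : M.N, ∃ s ∈ T, M.IsSeq n s ∧
    ∀ i : M.N, i < n → ∀ j : M.N, M.pair i j ∈ M.finSet s ↔ M.pair i j ∈ f

/-- Weak König's lemma: every infinite subtree of `2^{<ℕ}` has a path. -/
def WeakKonig (M : L2Structure.{u}) : Prop :=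
  ∀ T : Set M.N, M.IsBinTree T → M.IsInfinite T → ∃ f : Set M.N, M.IsPath f T

/-- `M` is a model of WKL₀, that is, of RCA₀ and weak König's lemma. -/
def ModelsWKL0 (M : L2Structure.{u}) : Prop :=
  M.ModelsRCA0 ∧ M.WeakKonig

/-! ### Partial orders -/

/-- `(P, R)` is a partial order; `M.pair x y ∈ R` means that `x` precedes or equals `y`. -/
structure IsPartialOrder (M : L2Structure.{u}) (P R : Set M.N) : Prop where
  mem_carrier : P ∈ M.S
  mem_rel : R ∈ M.S
  rel_subset : R ⊆ M.prod P P
  refl : ∀ x ∈ P, M.pair x x ∈ R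
  antisymm : ∀ x ∈ P, ∀ y ∈ P, M.pair x y ∈ R → M.pair y x ∈ R → x = y
  trans : ∀ x ∈ P, ∀ y ∈ P, ∀ z ∈ P, M.pair x y ∈ R → M.pair y z ∈ R → M.pair x z ∈ R

/-- `Int(P)`: the initial intervals of `P` (with order `R`) that are sets of the model. -/
def initialIntervals (M : L2Structure.{u}) (P R : Set M.N) : Set (Set M.N) :=
  {I | I ∈ M.S ∧ I ⊆ P ∧ ∀ x ∈ P, ∀ y ∈ P, M.pair x y ∈ R → y ∈ I → x ∈ I}

/-- `f` is an embedding of `(Q, RQ)` into `(P, RP)`. -/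
def IsEmbedding (M : L2Structure.{u}) (f Q RQ P RP : Set M.N) : Prop :=
  M.IsFunction f Q P ∧
  ∀ x ∈ Q, ∀ x' ∈ Q, ∀ y y' : M.N, M.pair x y ∈ f → M.pair x' y' ∈ f →
    (M.pair x x' ∈ RQ ↔ M.pair y y' ∈ RP)

/-- `f⁻¹(J)` for a function `f` with domain `Q`. -/
def preimage (M : L2Structure.{u}) (f Q J : Set M.N) : Set M.N :=
  {x | x ∈ Q ∧ ∃ y ∈ J, M.pair x y ∈ f}

/-- For every embedding `f` of a partial order `Q` into a partial order `P`,
`Int(Q) = {f⁻¹(J) : J ∈ Int(P)}`. (An equality of collections of subsets of the numbers, so it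
includes that every `f⁻¹(J)` is a set of the model.) -/
def EmbeddingStatement (M : L2Structure.{u}) : Prop :=
  ∀ Q RQ P RP f : Set M.N, M.IsPartialOrder Q RQ → M.IsPartialOrder P RP →
    M.IsEmbedding f Q RQ P RP →
    M.initialIntervals Q RQ = {I | ∃ J ∈ M.initialIntervals P RP, I = M.preimage f Q J}

/-- For every subset `Q` of a partial order `P`, with the induced order,
`Int(Q) = {J ∩ Q : J ∈ Int(P)}`. -/
def SubsetStatement (M : L2Structure.{u}) : Prop :=
  ∀ P R Q : Set M.N, M.IsPartialOrder P R → Q ∈ M.S → Q ⊆ P →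
    M.initialIntervals Q (R ∩ M.prod Q Q) = {I | ∃ J ∈ M.initialIntervals P R, I = J ∩ Q}

end L2Structure

set_option synthInstance.maxHeartbeats 400000
set_option synthInstance.maxSize 10000

/-! Weak König's lemma gives the embedding statement by compactness. For `I` in `Int(Q)`, the
downward closure of `f(I)` has the right preimage, but it is only `Σ⁰₁` and need not be a set. The
finite binary sequences that look like characteristic functions of an initial interval with preimage
`I` form a tree. Truncated downward closures show that it is infinite (`isInfinite_intervalTree`),
and a path is the required `J`. Conversely `f⁻¹(J)` is `Δ⁰₁`, because `f` is total and
single-valued. The subset statement is the case of an inclusion.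

The subset statement gives `Σ⁰₁` separation (`SubsetStatement.exists_separating`). Each `n` is put
below points of one kind, one for each witness of `A` at `n`, and above points of another kind, one
for each witness of `B`. The witness points form an antichain `Q`, and those of the first kind are
an initial interval of `Q`. Any initial interval of the whole order that extends it contains every
`n` in `A` and no `n` in `B`.

Separation gives weak König's lemma. For a finite sequence, let `A` say that at some level it
extends in `T` through the value `1` but not through `0`, and let `B` say the reverse. A separating
set `C` tells which value to take next, recursion along `C` gives a set `X`, and `Π⁰₁` induction
shows that its initial segments extend to every level (`IsRec.extendible`).

Since the model may be nonstandard and has only `Σ⁰₁` induction, finite sets are built with Gödel's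
moduli, and the search for sequences of a given length is bounded by `CodeBound`. Complexity is
tracked semantically: `Bdd` marks bounded quantifier properties, and type class inference verifies
it. -/

namespace L2Structure

/-! ### Semantic definability and its translation into formulas. -/

/-- Functions of assignments given by terms with number parameters. -/
class inductive Tm (M : L2Structure.{u}) : ((ℕ → M.N) → M.N) → Prop
  | var (k : ℕ) : Tm M (fun e => e k)
  | const (a : M.N) : Tm M (fun _ => a)
  | add {s t : (ℕ → M.N) → M.N} : Tm M s → Tm M t → Tm M (fun e => s e + t e)
  | mul {s t : (ℕ → M.N) → M.N} : Tm M s → Tm M t → Tm M (fun e => s e * t e)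

/-- Properties of assignments given by bounded quantifier formulas with number and set
parameters. -/
class inductive Bdd (M : L2Structure.{u}) : ((ℕ → M.N) → Prop) → Prop
  | eq {s t : (ℕ → M.N) → M.N} : Tm M s → Tm M t → Bdd M (fun e => s e = t e)
  | lt {s t : (ℕ → M.N) → M.N} : Tm M s → Tm M t → Bdd M (fun e => s e < t e)
  | mem {s : (ℕ → M.N) → M.N} {X : Set M.N} : Tm M s → X ∈ M.S → Bdd M (fun e => s e ∈ X)
  | neg {P : (ℕ → M.N) → Prop} : Bdd M P → Bdd M (fun e => ¬ P e)
  | and {P Q : (ℕ → M.N) → Prop} : Bdd M P → Bdd M Q → Bdd M (fun e => P e ∧ Q e)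
  | bex {t : (ℕ → M.N) → M.N} {P : (ℕ → M.N) → Prop} : Tm M t → Bdd M P →
      Bdd M (fun e => ∃ a : M.N, a < t e ∧ P (M.push a e))

variable {M : L2Structure.{u}}

/-- The maps `ρ` and `π` tell where variables and parameters sit in the ambient assignment. Because
they are chosen after `c`, two subterms can share one parameter list, the first using the even slots
and the second the odd ones. -/
theorem Tm.exists_numTerm {t : (ℕ → M.N) → M.N} (h : Tm M t) :
    ∃ c : ℕ → M.N, ∀ ρ π : ℕ → ℕ, ∃ τ : NumTerm, ∀ A : ℕ → M.N,
      (∀ i, A (π i) = c i) → t (fun k => A (ρ k)) = M.eval A τ := by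
  induction h with
  | var k => exact ⟨fun _ => 0, fun ρ π => ⟨.var (ρ k), fun A _ => rfl⟩⟩
  | const a => exact ⟨fun _ => a, fun ρ π => ⟨.var (π 0), fun A h => (h 0).symm⟩⟩
  | add _ _ ih₁ ih₂ =>
    obtain ⟨c₁, h₁⟩ := ih₁
    obtain ⟨c₂, h₂⟩ := ih₂
    refine ⟨fun i => if i % 2 = 0 then c₁ (i / 2) else c₂ (i / 2), fun ρ π => ?_⟩
    obtain ⟨τ₁, h₁⟩ := h₁ ρ (fun i => π (2 * i))
    obtain ⟨τ₂, h₂⟩ := h₂ ρ (fun i => π (2 * i + 1))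
    refine ⟨.add τ₁ τ₂, fun A hA => ?_⟩
    beta_reduce
    rw [h₁ A (fun i => by rw [hA]; simp), h₂ A (fun i => by rw [hA]; simp; congr 1; omega)]
    rfl
  | mul _ _ ih₁ ih₂ =>
    obtain ⟨c₁, h₁⟩ := ih₁
    obtain ⟨c₂, h₂⟩ := ih₂
    refine ⟨fun i => if i % 2 = 0 then c₁ (i / 2) else c₂ (i / 2), fun ρ π => ?_⟩
    obtain ⟨τ₁, h₁⟩ := h₁ ρ (fun i => π (2 * i))
    obtain ⟨τ₂, h₂⟩ := h₂ ρ (fun i => π (2 * i + 1))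
    refine ⟨.mul τ₁ τ₂, fun A hA => ?_⟩
    beta_reduce
    rw [h₁ A (fun i => by rw [hA]; simp), h₂ A (fun i => by rw [hA]; simp; congr 1; omega)]
    rfl

theorem Tm.exists_numTerm₂ {s t : (ℕ → M.N) → M.N} (hs : Tm M s) (ht : Tm M t) :
    ∃ c : ℕ → M.N, ∀ ρ π : ℕ → ℕ, ∃ σ τ : NumTerm, ∀ A : ℕ → M.N,
      (∀ i, A (π i) = c i) →
        s (fun k => A (ρ k)) = M.eval A σ ∧ t (fun k => A (ρ k)) = M.eval A τ := by
  obtain ⟨c₁, h₁⟩ := hs.exists_numTerm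
  obtain ⟨c₂, h₂⟩ := ht.exists_numTerm
  refine ⟨fun i => if i % 2 = 0 then c₁ (i / 2) else c₂ (i / 2), fun ρ π => ?_⟩
  obtain ⟨τ₁, h₁⟩ := h₁ ρ (fun i => π (2 * i))
  obtain ⟨τ₂, h₂⟩ := h₂ ρ (fun i => π (2 * i + 1))
  exact ⟨τ₁, τ₂, fun A hA => ⟨h₁ A (fun i => by rw [hA]; simp),
    h₂ A (fun i => by rw [hA]; simp; congr 1; omega)⟩⟩

theorem Bdd.exists_formula {R : (ℕ → M.N) → Prop} (h : Bdd M R) :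
    ∃ (c : ℕ → M.N) (X : ℕ → Set M.N), (∀ i, X i ∈ M.S) ∧ ∀ ρ π σ : ℕ → ℕ, ∃ φ : BddFormula,
      ∀ (A : ℕ → M.N) (E : ℕ → Set M.N), (∀ i, A (π i) = c i) → (∀ i, E (σ i) = X i) →
        (R (fun k => A (ρ k)) ↔ M.Holds E A φ) := by
  obtain ⟨Y, hY⟩ := M.S_nonempty
  induction h with
  | eq hs ht =>
    obtain ⟨c, h⟩ := hs.exists_numTerm₂ ht
    refine ⟨c, fun _ => Y, fun _ => hY, fun ρ π σ => ?_⟩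
    obtain ⟨τ₁, τ₂, h⟩ := h ρ π
    refine ⟨.eq τ₁ τ₂, fun A E hA hE => ?_⟩
    beta_reduce
    rw [(h A hA).1, (h A hA).2, Holds]
  | lt hs ht =>
    obtain ⟨c, h⟩ := hs.exists_numTerm₂ ht
    refine ⟨c, fun _ => Y, fun _ => hY, fun ρ π σ => ?_⟩
    obtain ⟨τ₁, τ₂, h⟩ := h ρ π
    refine ⟨.lt τ₁ τ₂, fun A E hA hE => ?_⟩
    beta_reduce
    rw [(h A hA).1, (h A hA).2, Holds]
  | @mem s X hs hX =>
    obtain ⟨c, h⟩ := hs.exists_numTerm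
    refine ⟨c, fun _ => X, fun _ => hX, fun ρ π σ => ?_⟩
    obtain ⟨τ, h⟩ := h ρ π
    refine ⟨.mem τ (σ 0), fun A E hA hE => ?_⟩
    beta_reduce
    rw [h A hA, Holds, hE]
  | neg _ ih =>
    obtain ⟨c, X, hX, h⟩ := ih
    refine ⟨c, X, hX, fun ρ π σ => ?_⟩
    obtain ⟨φ, h⟩ := h ρ π σ
    refine ⟨.neg φ, fun A E hA hE => ?_⟩
    beta_reduce
    rw [h A E hA hE, Holds]
  | and _ _ ih₁ ih₂ =>
    obtain ⟨c₁, X₁, hX₁, h₁⟩ := ih₁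
    obtain ⟨c₂, X₂, hX₂, h₂⟩ := ih₂
    refine ⟨fun i => if i % 2 = 0 then c₁ (i / 2) else c₂ (i / 2),
      fun i => if i % 2 = 0 then X₁ (i / 2) else X₂ (i / 2), fun i => ?_, fun ρ π σ => ?_⟩
    · dsimp only; split_ifs
      exacts [hX₁ _, hX₂ _]
    obtain ⟨φ₁, h₁⟩ := h₁ ρ (fun i => π (2 * i)) (fun i => σ (2 * i))
    obtain ⟨φ₂, h₂⟩ := h₂ ρ (fun i => π (2 * i + 1)) (fun i => σ (2 * i + 1))
    refine ⟨.and φ₁ φ₂, fun A E hA hE => ?_⟩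
    beta_reduce
    rw [h₁ A E (fun i => by rw [hA]; simp) (fun i => by rw [hE]; simp),
      h₂ A E (fun i => by rw [hA]; simp; congr 1; omega)
        (fun i => by rw [hE]; simp; congr 1; omega), Holds]
  | bex ht _ ih =>
    obtain ⟨c₁, h₁⟩ := ht.exists_numTerm
    obtain ⟨c₂, X, hX, h₂⟩ := ih
    refine ⟨fun i => if i % 2 = 0 then c₁ (i / 2) else c₂ (i / 2), X, hX, fun ρ π σ => ?_⟩
    obtain ⟨τ, h₁⟩ := h₁ ρ (fun i => π (2 * i))
    -- Under the quantifier the bound variable takes position `0`, and all other positions move up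
    -- by one.
    obtain ⟨φ, h₂⟩ := h₂ (fun k => Nat.casesOn k 0 (fun k => ρ k + 1))
      (fun i => π (2 * i + 1) + 1) σ
    refine ⟨.bex τ φ, fun A E hA hE => ?_⟩
    beta_reduce
    rw [h₁ A (fun i => by rw [hA]; simp), Holds]
    refine exists_congr fun a => and_congr Iff.rfl ?_
    rw [← h₂ (M.push a A) E (fun i => ?_) hE]
    · refine iff_of_eq (congrArg _ (funext fun k => ?_))
      cases k <;> rfl
    · change A (π (2 * i + 1)) = c₂ i
      rw [hA]; simp; congr 1; omega

-- As instances, the closure rules let the complexity of a property be inferred from its shape.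
attribute [instance] Tm.var Tm.const

instance Tm.instAdd {s t : (ℕ → M.N) → M.N} [Tm M s] [Tm M t] : Tm M (fun e => s e + t e) :=
  .add ‹_› ‹_›

instance Tm.instMul {s t : (ℕ → M.N) → M.N} [Tm M s] [Tm M t] : Tm M (fun e => s e * t e) :=
  .mul ‹_› ‹_›

instance Bdd.instEq {s t : (ℕ → M.N) → M.N} [Tm M s] [Tm M t] : Bdd M (fun e => s e = t e) :=
  .eq ‹_› ‹_›

instance Bdd.instLt {s t : (ℕ → M.N) → M.N} [Tm M s] [Tm M t] : Bdd M (fun e => s e < t e) :=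
  .lt ‹_› ‹_›

instance Bdd.instNeg {P : (ℕ → M.N) → Prop} [Bdd M P] : Bdd M (fun e => ¬ P e) :=
  .neg ‹_›

instance Bdd.instAnd {P Q : (ℕ → M.N) → Prop} [Bdd M P] [Bdd M Q] :
    Bdd M (fun e => P e ∧ Q e) :=
  .and ‹_› ‹_›

instance Bdd.instMem {s : (ℕ → M.N) → M.N} {X : Set M.N} [Tm M s] [h : Fact (X ∈ M.S)] :
    Bdd M (fun e => s e ∈ X) :=
  Bdd.mem ‹_› h.out

instance Bdd.exists_lt {t : (ℕ → M.N) → M.N} {R : M.N → (ℕ → M.N) → Prop} [Tm M t]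
    [h : Bdd M (fun e => R (e 0) (fun k => e (k + 1)))] :
    Bdd M (fun e => ∃ a : M.N, a < t e ∧ R a e) :=
  Bdd.bex ‹_› h

theorem Bdd.congr {P Q : (ℕ → M.N) → Prop} (h : Bdd M P) (hPQ : ∀ e, Q e ↔ P e) : Bdd M Q :=
  (funext fun e => propext (hPQ e) : Q = P) ▸ h

instance Bdd.or {P Q : (ℕ → M.N) → Prop} [Bdd M P] [Bdd M Q] : Bdd M (fun e => P e ∨ Q e) :=
  Bdd.congr (P := fun e => ¬ (¬ P e ∧ ¬ Q e)) inferInstance fun e => by tauto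

instance Bdd.imp {P Q : (ℕ → M.N) → Prop} [Bdd M P] [Bdd M Q] : Bdd M (fun e => P e → Q e) :=
  Bdd.congr (P := fun e => ¬ (P e ∧ ¬ Q e)) inferInstance fun e => by tauto

instance Bdd.iff {P Q : (ℕ → M.N) → Prop} [Bdd M P] [Bdd M Q] : Bdd M (fun e => P e ↔ Q e) :=
  Bdd.congr (P := fun e => (P e → Q e) ∧ (Q e → P e)) inferInstance fun e => by tauto

instance Bdd.forall_lt {t : (ℕ → M.N) → M.N} {R : M.N → (ℕ → M.N) → Prop} [Tm M t]
    [h : Bdd M (fun e => R (e 0) (fun k => e (k + 1)))] :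
    Bdd M (fun e => ∀ a : M.N, a < t e → R a e) :=
  Bdd.congr (P := fun e => ¬ ∃ a : M.N, a < t e ∧ ¬ R a e) inferInstance fun e => by push Not; rfl

theorem Tm.subst {t : (ℕ → M.N) → M.N} (h : Tm M t) {σ : ℕ → (ℕ → M.N) → M.N}
    (hσ : ∀ k, Tm M (σ k)) : Tm M (fun e => t (fun k => σ k e)) := by
  induction h with
  | var k => exact hσ k
  | const a => exact .const a
  | add _ _ ih₁ ih₂ => exact .add ih₁ ih₂
  | mul _ _ ih₁ ih₂ => exact .mul ih₁ ih₂

/-- With substitution, a new predicate has to be checked only on the variables `e 0`, `e 1`, `e 2`;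
the `comp` lemmas then apply it to arbitrary terms. -/
theorem Bdd.subst {R : (ℕ → M.N) → Prop} (h : Bdd M R) {σ : ℕ → (ℕ → M.N) → M.N}
    (hσ : ∀ k, Tm M (σ k)) : Bdd M (fun e => R (fun k => σ k e)) := by
  induction h generalizing σ with
  | eq hs ht => exact .eq (hs.subst hσ) (ht.subst hσ)
  | lt hs ht => exact .lt (hs.subst hσ) (ht.subst hσ)
  | mem hs hX => exact .mem (hs.subst hσ) hX
  | neg _ ih => exact .neg (ih hσ)
  | and _ _ ih₁ ih₂ => exact .and (ih₁ hσ) (ih₂ hσ)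
  | @bex t P ht _ ih =>
    refine (Bdd.bex (ht.subst hσ) (ih (σ := fun k => Nat.casesOn k (fun e => e 0)
      (fun k e => σ k (fun j => e (j + 1)))) fun k => ?_)).congr fun e => ?_
    · cases k with
      | zero => exact .var 0
      | succ k => exact (hσ k).subst fun j => .var (j + 1)
    · refine exists_congr fun a => and_congr Iff.rfl (iff_of_eq (congrArg P (funext fun k => ?_)))
      cases k <;> rfl

theorem Bdd.comp₁ {R : M.N → Prop} (h : Bdd M (fun e => R (e 0))) {s : (ℕ → M.N) → M.N}
    [hs : Tm M s] : Bdd M (fun e => R (s e)) :=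
  h.subst (σ := fun _ => s) fun _ => hs

theorem Bdd.comp₂ {R : M.N → M.N → Prop} (h : Bdd M (fun e => R (e 0) (e 1)))
    {s t : (ℕ → M.N) → M.N} [Tm M s] [Tm M t] : Bdd M (fun e => R (s e) (t e)) :=
  h.subst (σ := fun k => Nat.casesOn k s fun _ => t) fun k => by cases k <;> assumption

theorem Bdd.comp₃ {R : M.N → M.N → M.N → Prop} (h : Bdd M (fun e => R (e 0) (e 1) (e 2)))
    {s t r : (ℕ → M.N) → M.N} [Tm M s] [Tm M t] [Tm M r] :
    Bdd M (fun e => R (s e) (t e) (r e)) :=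
  h.subst (σ := fun k => Nat.casesOn k s fun k => Nat.casesOn k t fun _ => r) fun k => by
    rcases k with _ | _ | k <;> assumption

instance Tm.pair {s t : (ℕ → M.N) → M.N} [Tm M s] [Tm M t] :
    Tm M (fun e => M.pair (s e) (t e)) :=
  inferInstanceAs (Tm M (fun e => (s e + t e) * (s e + t e) + s e))

theorem Bdd.exists_formula_push (R : M.N → M.N → Prop) [h : Bdd M (fun e => R (e 0) (e 1))] :
    ∃ (c : ℕ → M.N) (X : ℕ → Set M.N), (∀ i, X i ∈ M.S) ∧ ∃ φ : BddFormula,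
      ∀ m n, R m n ↔ M.Holds X (M.push m (M.push n c)) φ := by
  obtain ⟨c, X, hX, h⟩ := h.exists_formula
  obtain ⟨φ, h⟩ := h id (· + 2) id
  exact ⟨c, X, hX, φ, fun m n => h (M.push m (M.push n c)) X (fun _ => rfl) fun _ => rfl⟩

/-- Two bounded quantifier properties are given by formulas with common parameters. -/
theorem Bdd.exists_formula_push₂ (R Q : M.N → M.N → Prop) [h₁ : Bdd M (fun e => R (e 0) (e 1))]
    [h₂ : Bdd M (fun e => Q (e 0) (e 1))] :
    ∃ (c : ℕ → M.N) (X : ℕ → Set M.N), (∀ i, X i ∈ M.S) ∧ ∃ φ ψ : BddFormula,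
      (∀ m n, R m n ↔ M.Holds X (M.push m (M.push n c)) φ) ∧
      ∀ m n, Q m n ↔ M.Holds X (M.push m (M.push n c)) ψ := by
  obtain ⟨c₁, X₁, hX₁, h₁⟩ := h₁.exists_formula
  obtain ⟨c₂, X₂, hX₂, h₂⟩ := h₂.exists_formula
  -- Number positions `0` and `1` hold `m` and `n`, so the interleaved number parameters start at
  -- `2`; the set parameters need no shift.
  obtain ⟨φ, h₁⟩ := h₁ id (fun i => 2 * i + 2) (fun i => 2 * i)
  obtain ⟨ψ, h₂⟩ := h₂ id (fun i => 2 * i + 3) (fun i => 2 * i + 1)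
  refine ⟨fun i => if i % 2 = 0 then c₁ (i / 2) else c₂ (i / 2),
    fun i => if i % 2 = 0 then X₁ (i / 2) else X₂ (i / 2), fun i => ?_, φ, ψ,
    fun m n => h₁ (M.push m (M.push n _)) _ (fun i => ?_) fun i => ?_,
    fun m n => h₂ (M.push m (M.push n _)) _ (fun i => ?_) fun i => ?_⟩
  · dsimp only; split_ifs
    exacts [hX₁ _, hX₂ _]
  · simp [push]
  · simp
  · simp [push]; congr 1; omega
  · simp; congr 1; omega

/-! ### Induction and comprehension for semantic properties. -/

theorem ModelsRCA0.induction_exists (hM : M.ModelsRCA0) (R : M.N → M.N → Prop)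
    [Bdd M (fun e => R (e 0) (e 1))] (h0 : ∃ m, R m 0)
    (hs : ∀ n, (∃ m, R m n) → ∃ m, R m (n + 1)) (n : M.N) : ∃ m, R m n := by
  obtain ⟨c, X, hX, φ, h⟩ := Bdd.exists_formula_push R
  have key := hM.sigma1_induction φ c X hX
  simp only [Sigma1, ← h] at key
  exact key h0 hs n

theorem ModelsRCA0.induction (hM : M.ModelsRCA0) (R : M.N → Prop) [h : Bdd M (fun e => R (e 0))]
    (h0 : R 0) (hs : ∀ n, R n → R (n + 1)) (n : M.N) : R n := by
  have : Bdd M (fun e => R (e 1)) := h.comp₁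
  have := hM.induction_exists (fun _ n => R n) ⟨0, h0⟩ (fun n ⟨_, h⟩ => ⟨0, hs n h⟩) n
  exact this.elim fun _ h => h

theorem ModelsRCA0.comprehension (hM : M.ModelsRCA0) (R Q : M.N → M.N → Prop)
    [Bdd M (fun e => R (e 0) (e 1))] [Bdd M (fun e => Q (e 0) (e 1))]
    (hRQ : ∀ n, (∃ m, R m n) ↔ ∀ m, Q m n) : {n | ∃ m, R m n} ∈ M.S := by
  obtain ⟨c, X, hX, φ, ψ, h₁, h₂⟩ := Bdd.exists_formula_push₂ R Q
  have key := hM.delta1_comprehension φ ψ c X hX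
  simp only [Sigma1, Pi1, ← h₁, ← h₂] at key
  exact key hRQ

theorem ModelsRCA0.setOf_mem (hM : M.ModelsRCA0) (R : M.N → Prop)
    [h : Bdd M (fun e => R (e 0))] : {n | R n} ∈ M.S := by
  have : Bdd M (fun e => R (e 1)) := h.comp₁
  have := hM.comprehension (fun _ n => R n) (fun _ n => R n) fun n =>
    ⟨fun ⟨_, h⟩ _ => h, fun h => ⟨0, h 0⟩⟩
  simpa using this

/-! ### Arithmetic from the basic axioms. -/

namespace ModelsRCA0

theorem zero_add (hM : M.ModelsRCA0) (n : M.N) : 0 + n = n :=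
  hM.induction (fun n => 0 + n = n) (hM.add_zero 0) (fun n ih => by rw [hM.add_succ, ih]) n

theorem succ_add (hM : M.ModelsRCA0) (m n : M.N) : m + 1 + n = m + n + 1 :=
  hM.induction (fun n => m + 1 + n = m + n + 1) (by rw [hM.add_zero, hM.add_zero])
    (fun n ih => by rw [hM.add_succ, hM.add_succ, ih]) n

theorem add_comm (hM : M.ModelsRCA0) (m n : M.N) : m + n = n + m :=
  hM.induction (fun n => m + n = n + m) (by rw [hM.add_zero, hM.zero_add])
    (fun n ih => by rw [hM.add_succ, hM.succ_add, ih]) n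

theorem add_assoc (hM : M.ModelsRCA0) (m n k : M.N) : m + n + k = m + (n + k) :=
  hM.induction (fun k => m + n + k = m + (n + k)) (by rw [hM.add_zero, hM.add_zero])
    (fun n ih => by rw [hM.add_succ, hM.add_succ, hM.add_succ, ih]) k

theorem zero_mul (hM : M.ModelsRCA0) (n : M.N) : 0 * n = 0 :=
  hM.induction (fun n => 0 * n = 0) (hM.mul_zero 0)
    (fun n ih => by rw [hM.mul_succ, ih, hM.add_zero]) n

theorem succ_mul (hM : M.ModelsRCA0) (m n : M.N) : (m + 1) * n = m * n + n :=
  hM.induction (fun n => (m + 1) * n = m * n + n)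
    (by rw [hM.mul_zero, hM.mul_zero, hM.add_zero])
    (fun n ih => by
      rw [hM.mul_succ, hM.mul_succ, ih, hM.add_assoc, hM.add_assoc, hM.add_comm n (m + 1),
        hM.succ_add, hM.add_succ m n]) n

theorem mul_comm (hM : M.ModelsRCA0) (m n : M.N) : m * n = n * m :=
  hM.induction (fun n => m * n = n * m) (by rw [hM.mul_zero, hM.zero_mul])
    (fun n ih => by rw [hM.mul_succ, hM.succ_mul, ih]) n

theorem mul_add (hM : M.ModelsRCA0) (m n k : M.N) : m * (n + k) = m * n + m * k :=
  hM.induction (fun k => m * (n + k) = m * n + m * k)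
    (by rw [hM.mul_zero, hM.add_zero, hM.add_zero])
    (fun n ih => by rw [hM.add_succ, hM.mul_succ, hM.mul_succ, ih, hM.add_assoc]) k

theorem mul_assoc (hM : M.ModelsRCA0) (m n k : M.N) : m * n * k = m * (n * k) :=
  hM.induction (fun k => m * n * k = m * (n * k))
    (by rw [hM.mul_zero, hM.mul_zero, hM.mul_zero])
    (fun n ih => by rw [hM.mul_succ, hM.mul_succ, hM.mul_add, ih]) k

theorem mul_one (hM : M.ModelsRCA0) (m : M.N) : m * 1 = m := by
  rw [← hM.zero_add 1, hM.mul_succ, hM.mul_zero, hM.zero_add]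

theorem add_right_cancel (hM : M.ModelsRCA0) (m n k : M.N) : m + k = n + k → m = n :=
  hM.induction (fun k => m + k = n + k → m = n) (by simp [hM.add_zero])
    (fun k ih h => ih (hM.succ_inj _ _ (by rwa [hM.add_succ, hM.add_succ] at h))) k

theorem eq_zero_or_succ (hM : M.ModelsRCA0) (n : M.N) : n = 0 ∨ ∃ m : M.N, n = m + 1 := by
  -- The added clause `m < n` makes the property bounded.
  have := hM.induction (fun n => n = 0 ∨ ∃ m : M.N, m < n ∧ n = m + 1) (.inl rfl)
    (fun n _ => .inr ⟨n, (hM.lt_succ n n).2 (.inr rfl), rfl⟩) n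
  exact this.imp_right fun ⟨m, h⟩ => ⟨m, h.2⟩

theorem lt_add_succ (hM : M.ModelsRCA0) (m k : M.N) : m < m + k + 1 :=
  hM.induction (fun k => m < m + k + 1)
    (by rw [hM.add_zero]; exact (hM.lt_succ m m).2 (.inr rfl))
    (fun k ih => by rw [hM.add_succ]; exact (hM.lt_succ _ _).2 (.inl ih)) k

theorem lt_iff (hM : M.ModelsRCA0) (m n : M.N) : m < n ↔ ∃ k : M.N, n = m + k + 1 := by
  refine ⟨fun h => ?_, fun ⟨k, h⟩ => h ▸ hM.lt_add_succ m k⟩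
  have := hM.induction_exists (fun k n => m < n → n = m + k + 1)
    ⟨0, fun h => (hM.not_lt_zero _ h).elim⟩ (fun n ⟨k, hk⟩ => by
      by_cases h : m < n
      · exact ⟨k + 1, fun _ => by rw [hM.add_succ, hk h]⟩
      -- Here `m < n + 1` can hold only with `m = n`, and then `k = 0` is right.
      · refine ⟨0, fun h' => ?_⟩
        rw [hM.add_zero, ((hM.lt_succ m n).1 h').resolve_left h]) n
  exact this.imp fun k hk => hk h

theorem le_iff (hM : M.ModelsRCA0) (m n : M.N) : m < n ∨ m = n ↔ ∃ k : M.N, n = m + k := by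
  rw [hM.lt_iff]
  constructor
  · rintro (⟨k, h⟩ | rfl)
    · exact ⟨k + 1, by rw [hM.add_succ, h]⟩
    · exact ⟨0, (hM.add_zero _).symm⟩
  · rintro ⟨k, h⟩
    rcases hM.eq_zero_or_succ k with rfl | ⟨j, rfl⟩
    · exact .inr (by rw [h, hM.add_zero])
    · exact .inl ⟨j, by rw [h, hM.add_succ]⟩

theorem lt_irrefl (hM : M.ModelsRCA0) (m : M.N) : ¬ m < m := by
  rw [hM.lt_iff]
  rintro ⟨k, h⟩
  rw [hM.add_comm m, ← hM.succ_add] at h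
  exact hM.succ_ne_zero k (hM.add_right_cancel _ _ m ((hM.zero_add m).trans h)).symm

theorem lt_trichotomy (hM : M.ModelsRCA0) (m n : M.N) : m < n ∨ m = n ∨ n < m := by
  refine hM.induction (fun n => m < n ∨ m = n ∨ n < m) ?_ (fun n ih => ?_) n
  · rcases hM.eq_zero_or_succ m with h | ⟨k, h⟩
    · exact .inr (.inl h)
    · exact .inr (.inr ((hM.lt_iff _ _).2 ⟨k, by rw [hM.zero_add, h]⟩))
  · rcases ih with h | h | h
    · exact .inl ((hM.lt_succ _ _).2 (.inl h))
    · exact .inl ((hM.lt_succ _ _).2 (.inr h))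
    · obtain ⟨k, rfl⟩ := (hM.lt_iff _ _).1 h
      rcases hM.eq_zero_or_succ k with rfl | ⟨j, rfl⟩
      · exact .inr (.inl (by rw [hM.add_zero]))
      · exact .inr (.inr ((hM.lt_iff _ _).2 ⟨j, by rw [hM.add_succ, hM.succ_add n j]⟩))

theorem lt_trans (hM : M.ModelsRCA0) {a b c : M.N} (h : a < b) (h' : b < c) : a < c := by
  obtain ⟨k, rfl⟩ := (hM.lt_iff _ _).1 h
  obtain ⟨j, rfl⟩ := (hM.lt_iff _ _).1 h'
  exact (hM.lt_iff _ _).2 ⟨k + 1 + j, by rw [← hM.add_assoc, ← hM.add_assoc]⟩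

end ModelsRCA0

/-! ### The numbers as an ordered semiring, and derived induction principles. -/

variable [hM : Fact M.ModelsRCA0]

instance instCommSemiring : CommSemiring M.N where
  add_assoc := hM.out.add_assoc
  zero_add := hM.out.zero_add
  add_zero := hM.out.add_zero
  add_comm := hM.out.add_comm
  mul_assoc := hM.out.mul_assoc
  zero_mul := hM.out.zero_mul
  mul_zero := hM.out.mul_zero
  one_mul m := (hM.out.mul_comm 1 m).trans (hM.out.mul_one m)
  mul_one := hM.out.mul_one
  mul_comm := hM.out.mul_comm
  left_distrib := hM.out.mul_add
  right_distrib m n k := by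
    rw [hM.out.mul_comm, hM.out.mul_add, hM.out.mul_comm k m, hM.out.mul_comm k n]
  nsmul := nsmulRec
  npow := npowRec

noncomputable instance instLinearOrder : LinearOrder M.N where
  le m n := m < n ∨ m = n
  le_refl _ := .inr rfl
  le_trans a b c := by
    rintro (h | rfl) (h' | rfl)
    exacts [.inl (hM.out.lt_trans h h'), .inl h, .inl h', .inr rfl]
  lt_iff_le_not_ge a b := by
    constructor
    · refine fun h => ⟨.inl h, ?_⟩
      rintro (h' | rfl)
      exacts [hM.out.lt_irrefl _ (hM.out.lt_trans h h'), hM.out.lt_irrefl _ h]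
    · rintro ⟨h | rfl, h'⟩
      exacts [h, (h' (.inr rfl)).elim]
  le_antisymm a b := by
    rintro (h | rfl) (h' | h')
    exacts [(hM.out.lt_irrefl _ (hM.out.lt_trans h h')).elim, h'.symm, rfl, rfl]
  le_total a b := by
    rcases hM.out.lt_trichotomy a b with h | h | h
    exacts [.inl (.inl h), .inl (.inr h), .inr (.inl h)]
  toDecidableLE := Classical.decRel _

theorem lt_add_one_iff {m n : M.N} : m < n + 1 ↔ m ≤ n := hM.out.lt_succ m n

instance : CanonicallyOrderedAdd M.N where
  exists_add_of_le h := (hM.out.le_iff _ _).1 h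
  le_self_add _ n := (hM.out.le_iff _ _).2 ⟨n, rfl⟩
  le_add_self m n := (hM.out.le_iff _ _).2 ⟨n, hM.out.add_comm n m⟩

theorem lt_iff_exists_add_one {m n : M.N} : m < n ↔ ∃ k, n = m + k + 1 := hM.out.lt_iff m n

instance : IsStrictOrderedRing M.N where
  add_le_add_left a b h c := by
    obtain ⟨k, rfl⟩ := exists_add_of_le h
    rw [add_right_comm]
    exact le_self_add
  le_of_add_le_add_left a b c h := by
    obtain ⟨k, h⟩ := exists_add_of_le h
    rw [add_assoc, add_comm a, add_comm a] at h
    rw [hM.out.add_right_cancel _ _ _ h]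
    exact le_self_add
  le_of_add_le_add_right a b c h := by
    obtain ⟨k, h⟩ := exists_add_of_le h
    rw [add_right_comm] at h
    rw [hM.out.add_right_cancel _ _ _ h]
    exact le_self_add
  zero_le_one := zero_le
  exists_pair_ne := ⟨0, 0 + 1, (hM.out.succ_ne_zero 0).symm⟩
  mul_lt_mul_of_pos_left a ha b c h := by
    obtain ⟨k, rfl⟩ := lt_iff_exists_add_one.1 h
    obtain ⟨j, rfl⟩ := lt_iff_exists_add_one.1 ha
    exact lt_iff_exists_add_one.2 ⟨(0 + j + 1) * k + j, by ring⟩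
  mul_lt_mul_of_pos_right a ha b c h := by
    obtain ⟨k, rfl⟩ := lt_iff_exists_add_one.1 h
    obtain ⟨j, rfl⟩ := lt_iff_exists_add_one.1 ha
    exact lt_iff_exists_add_one.2 ⟨(0 + j + 1) * k + j, by ring⟩

theorem add_one_le_iff {m n : M.N} : m + 1 ≤ n ↔ m < n := by
  rw [← lt_add_one_iff, add_lt_add_iff_right]


instance Bdd.le {s t : (ℕ → M.N) → M.N} [Tm M s] [Tm M t] : Bdd M (fun e => s e ≤ t e) :=
  Bdd.congr (P := fun e => s e < t e + 1) inferInstance fun _ => lt_add_one_iff.symm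

theorem induction_exists (R : M.N → M.N → Prop) (h0 : ∃ m, R m 0)
    (hs : ∀ n, (∃ m, R m n) → ∃ m, R m (n + 1)) (n : M.N)
    (_h : Bdd M (fun e => R (e 0) (e 1)) := by infer_instance) : ∃ m, R m n :=
  hM.out.induction_exists R h0 hs n

theorem induction_bdd (R : M.N → Prop) (h0 : R 0) (hs : ∀ n, R n → R (n + 1)) (n : M.N)
    (_h : Bdd M (fun e => R (e 0)) := by infer_instance) : R n :=
  hM.out.induction R h0 hs n

theorem strong_induction (R : M.N → Prop) (hs : ∀ n, (∀ k, k < n → R k) → R n) (n : M.N)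
    (h : Bdd M (fun e => R (e 0)) := by infer_instance) : R n := by
  have := @Bdd.comp₁ M R h
  refine hs n (induction_bdd (fun n => ∀ k, k < n → R k) (fun k h => (not_lt_zero h).elim)
    (fun n ih k hk => ?_) n)
  rcases (lt_add_one_iff.1 hk).lt_or_eq with h | rfl
  exacts [ih k h, hs k ih]

theorem exists_least (R : M.N → Prop) {n : M.N} (hn : R n)
    (h : Bdd M (fun e => R (e 0)) := by infer_instance) :
    ∃ m, R m ∧ m ≤ n ∧ ∀ k, k < m → ¬ R k := by
  by_contra! H
  refine strong_induction (fun k => k ≤ n → ¬ R k) (fun m ih hm hR => ?_) n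
    (by infer_instance) le_rfl hn
  obtain ⟨k, hk, hk'⟩ := H m hR hm
  exact ih k hk (hk.le.trans hm) hk'

/-- Induction for `Π⁰₁` properties. -/
theorem induction_forall (R : M.N → M.N → Prop) (h0 : ∀ m, R m 0)
    (hs : ∀ n, (∀ m, R m n) → ∀ m, R m (n + 1)) (n m : M.N)
    (h : Bdd M (fun e => R (e 0) (e 1)) := by infer_instance) : R m n := by
  by_contra hR
  have := @Bdd.comp₂ M R h
  -- A failure at `n` is carried downwards: the `Σ⁰₁` property of `k` is that some instance fails at
  -- `n - k`, where `y` stands for the difference. At `k = n` this contradicts the base case.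
  have key := induction_exists
    (fun x k => k ≤ n → ∃ y, y < n + 1 ∧ k + y = n ∧ ¬ R x y)
    ⟨m, fun _ => ⟨n, lt_add_one_iff.2 le_rfl, zero_add n, hR⟩⟩ (fun k ⟨x, hx⟩ => ?_) n
  · obtain ⟨x, hx⟩ := key
    obtain ⟨y, _, hy, hy'⟩ := hx le_rfl
    obtain rfl : y = 0 := by simpa using hy
    exact hy' (h0 x)
  · by_cases hk : k + 1 ≤ n
    · obtain ⟨y, hyn, rfl, hy'⟩ := hx (le_self_add.trans hk)
      rcases hM.out.eq_zero_or_succ y with rfl | ⟨z, rfl⟩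
      · exact (hy' (h0 x)).elim
      · obtain ⟨x', hx'⟩ : ∃ x', ¬ R x' z := by
          by_contra! H
          exact hy' (hs z H x)
        refine ⟨x', fun _ => ⟨z, ?_, by ring, hx'⟩⟩
        exact lt_of_le_of_lt le_self_add hyn
    · exact ⟨0, fun h => (hk h).elim⟩

theorem setOf_mem (R : M.N → Prop) (_h : Bdd M (fun e => R (e 0)) := by infer_instance) :
    {n | R n} ∈ M.S :=
  hM.out.setOf_mem R

/-- `Δ⁰₁` comprehension. -/
theorem setOf_exists_mem (R Q : M.N → M.N → Prop) (hRQ : ∀ n, (∃ m, R m n) ↔ ∀ m, Q m n)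
    (_h : Bdd M (fun e => R (e 0) (e 1)) := by infer_instance)
    (_h' : Bdd M (fun e => Q (e 0) (e 1)) := by infer_instance) : {n | ∃ m, R m n} ∈ M.S :=
  hM.out.comprehension R Q hRQ

theorem le_mul_of_pos {a b : M.N} (h : 0 < a) : b ≤ a * b := by
  obtain ⟨k, rfl⟩ := lt_iff_exists_add_one.1 h
  exact le_iff_exists_add.2 ⟨k * b, by ring⟩

/-- In the absence of subtraction, the two quotients are compared and their difference is the new
quotient. -/
theorem dvd_of_dvd_add {a b c : M.N} (h : a ∣ b + c) (hb : a ∣ b) : a ∣ c := by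
  obtain ⟨p, hp⟩ := h
  obtain ⟨q, rfl⟩ := hb
  rcases eq_zero_or_pos a with rfl | ha
  · exact ⟨0, by simpa using hp⟩
  · have hqp : q ≤ p := by
      by_contra! hlt
      have h₁ := mul_lt_mul_of_pos_left hlt ha
      have h₂ : a * q ≤ a * p := hp ▸ le_self_add
      exact absurd h₁ h₂.not_gt
    obtain ⟨r, rfl⟩ := exists_add_of_le hqp
    exact ⟨r, by rw [mul_add] at hp; exact add_left_cancel hp⟩

/-- A quotient is at most `b` if `a` is positive; if `a = 0`, then `0` serves. Hence divisibility is
a bounded property. -/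
theorem dvd_iff_exists_lt {a b : M.N} : a ∣ b ↔ ∃ q : M.N, q < b + 1 ∧ b = a * q := by
  constructor
  · rintro ⟨q, hq⟩
    rcases eq_zero_or_pos a with h | h
    · exact ⟨0, lt_add_one_iff.2 zero_le, by rw [hq, h]; simp⟩
    · exact ⟨q, lt_add_one_iff.2 (hq ▸ le_mul_of_pos h), hq⟩
  · rintro ⟨q, _, hq⟩
    exact ⟨q, hq⟩

instance Bdd.dvd {s t : (ℕ → M.N) → M.N} [Tm M s] [Tm M t] : Bdd M (fun e => s e ∣ t e) := by
  have h : Bdd M (fun e => e 0 ∣ e 1) :=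
    Bdd.congr (P := fun e => ∃ q : M.N, q < e 1 + 1 ∧ e 1 = e 0 * q) inferInstance
      fun e => dvd_iff_exists_lt
  exact h.comp₂ (R := fun a b => a ∣ b)

/-! ### Pairs -/

theorem le_mul_self (a : M.N) : a ≤ a * a := by
  rcases eq_zero_or_pos a with rfl | h
  · simp
  · exact le_mul_of_pos h

theorem left_le_pair (i j : M.N) : i ≤ M.pair i j := le_add_self

theorem right_le_pair (i j : M.N) : j ≤ M.pair i j :=
  le_add_self.trans ((le_mul_self (i + j)).trans le_self_add)

theorem pair_le_pair {i j i' j' : M.N} (hi : i ≤ i') (hj : j ≤ j') :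
    M.pair i j ≤ M.pair i' j' := by
  unfold pair
  gcongr

theorem pair_lt_pair_left {i j i' j' : M.N} (hi : i < i') (hj : j ≤ j') :
    M.pair i j < M.pair i' j' := by
  unfold pair
  exact add_lt_add_of_le_of_lt (by gcongr) hi

/-- With `s = i + j`, the code `s² + i` is below `(s + 1)²`, so codes with different sums lie in
disjoint ranges. This makes pairing injective. -/
theorem pair_lt_of_add_lt {i j i' j' : M.N} (h : i + j < i' + j') :
    M.pair i j < M.pair i' j' := by
  unfold pair
  have h₁ := add_one_le_iff.2 h
  refine lt_of_lt_of_le ?_ ((mul_le_mul' h₁ h₁).trans le_self_add)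
  exact lt_iff_exists_add_one.2 ⟨i + j + j, by ring⟩

theorem pair_inj {i j i' j' : M.N} : M.pair i j = M.pair i' j' ↔ i = i' ∧ j = j' := by
  refine ⟨fun h => ?_, fun ⟨h, h'⟩ => h ▸ h' ▸ rfl⟩
  have hs : i + j = i' + j' := by
    rcases lt_trichotomy (i + j) (i' + j') with h' | h' | h'
    · exact absurd h (pair_lt_of_add_lt h').ne
    · exact h'
    · exact absurd h (pair_lt_of_add_lt h').ne'
  unfold pair at h
  rw [hs] at h
  obtain rfl := add_left_cancel h
  exact ⟨rfl, add_left_cancel hs⟩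

theorem pair_mem_prod {X Y : Set M.N} {i j : M.N} :
    M.pair i j ∈ M.prod X Y ↔ i ∈ X ∧ j ∈ Y := by
  constructor
  · rintro ⟨i', hi, j', hj, h⟩
    obtain ⟨rfl, rfl⟩ := pair_inj.1 h
    exact ⟨hi, hj⟩
  · exact fun ⟨hi, hj⟩ => ⟨i, hi, j, hj, rfl⟩

/-! ### Codes of finite sets -/

theorem mem_finSet_pair {i k m n : M.N} :
    i ∈ M.finSet (M.pair k (M.pair m n)) ↔ i < k ∧ m * (i + 1) + 1 ∣ n := by
  constructor
  · rintro ⟨k', m', n', h, hi, hn⟩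
    obtain ⟨rfl, h₁⟩ := pair_inj.1 h
    obtain ⟨rfl, rfl⟩ := pair_inj.1 h₁
    exact ⟨hi, hn⟩
  · exact fun ⟨hi, hn⟩ => ⟨k, m, n, rfl, hi, hn⟩

theorem lt_of_mem_finSet {i c : M.N} (h : i ∈ M.finSet c) : i < c := by
  obtain ⟨k, m, n, rfl, hi, _⟩ := h
  exact hi.trans_le (left_le_pair _ _)

theorem exists_triple_iff {c : M.N} {P : M.N → M.N → M.N → Prop} :
    (∃ k m n : M.N, c = M.pair k (M.pair m n) ∧ P k m n) ↔
      ∃ k, k < c + 1 ∧ ∃ m, m < c + 1 ∧ ∃ n, n < c + 1 ∧ c = M.pair k (M.pair m n) ∧ P k m n := by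
  constructor
  · rintro ⟨k, m, n, rfl, h⟩
    refine ⟨k, ?_, m, ?_, n, ?_, rfl, h⟩ <;> rw [lt_add_one_iff]
    · exact left_le_pair _ _
    · exact (left_le_pair _ _).trans (right_le_pair _ _)
    · exact (right_le_pair _ _).trans (right_le_pair _ _)
  · rintro ⟨k, _, m, _, n, _, h⟩
    exact ⟨k, m, n, h⟩

instance Bdd.finSet {s t : (ℕ → M.N) → M.N} [Tm M s] [Tm M t] :
    Bdd M (fun e => s e ∈ M.finSet (t e)) := by
  have h : Bdd M (fun e => e 0 ∈ M.finSet (e 1)) :=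
    Bdd.congr (P := fun e => ∃ k, k < e 1 + 1 ∧ ∃ m, m < e 1 + 1 ∧ ∃ n, n < e 1 + 1 ∧
      e 1 = M.pair k (M.pair m n) ∧ e 0 < k ∧ m * (e 0 + 1) + 1 ∣ n) (by infer_instance)
      fun e => exists_triple_iff (P := fun k m n => e 0 < k ∧ m * (e 0 + 1) + 1 ∣ n)
  exact h.comp₂ (R := fun i c => i ∈ M.finSet c)

/-- `c` has the form of a code of a finite set. -/
def IsTriple (M : L2Structure.{u}) (c : M.N) : Prop :=
  ∃ k m n : M.N, c = M.pair k (M.pair m n)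

instance Bdd.isTriple {t : (ℕ → M.N) → M.N} [Tm M t] : Bdd M (fun e => M.IsTriple (t e)) := by
  have h : Bdd M (fun e => M.IsTriple (e 0)) :=
    Bdd.congr (P := fun e => ∃ k, k < e 0 + 1 ∧ ∃ m, m < e 0 + 1 ∧ ∃ n, n < e 0 + 1 ∧
      -- The conjunct `e 0 = e 0` plays the part of `True`.
      e 0 = M.pair k (M.pair m n) ∧ e 0 = e 0) inferInstance
      fun e => by simpa [IsTriple] using exists_triple_iff (c := e 0) (P := fun _ _ _ => True)
  exact h.comp₁

theorem finSet_eq_iff {c d : M.N} :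
    M.finSet c = M.finSet d ↔ ∀ i, i < c + d → (i ∈ M.finSet c ↔ i ∈ M.finSet d) := by
  refine ⟨fun h i _ => h ▸ Iff.rfl, fun h => Set.ext fun i => ⟨fun hi => ?_, fun hi => ?_⟩⟩
  · exact (h i ((lt_of_mem_finSet hi).trans_le le_self_add)).1 hi
  · exact (h i ((lt_of_mem_finSet hi).trans_le le_add_self)).2 hi

instance Bdd.finSet_eq {s t : (ℕ → M.N) → M.N} [Tm M s] [Tm M t] :
    Bdd M (fun e => M.finSet (s e) = M.finSet (t e)) :=
  Bdd.congr (P := fun e => ∀ i, i < s e + t e → (i ∈ M.finSet (s e) ↔ i ∈ M.finSet (t e)))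
    (by
      have h : Bdd M (fun e => ∀ i, i < e 0 + e 1 →
        (i ∈ M.finSet (e 0) ↔ i ∈ M.finSet (e 1))) := inferInstance
      exact h.comp₂ (R := fun a b => ∀ i, i < a + b → (i ∈ M.finSet a ↔ i ∈ M.finSet b)))
    fun e => finSet_eq_iff

instance Bdd.isFinCode {t : (ℕ → M.N) → M.N} [Tm M t] : Bdd M (fun e => M.IsFinCode (t e)) := by
  have h : Bdd M (fun e => M.IsTriple (e 0) ∧ ∀ d, d < e 0 → M.IsTriple d →
    ¬ M.finSet d = M.finSet (e 0)) := inferInstance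
  exact h.comp₁ (R := M.IsFinCode)

theorem exists_isFinCode_le {c : M.N} (hc : M.IsTriple c) :
    ∃ d, d ≤ c ∧ M.IsFinCode d ∧ M.finSet d = M.finSet c := by
  obtain ⟨d, ⟨h₁, h₂⟩, h₃, h₄⟩ :=
    exists_least (fun d => M.IsTriple d ∧ M.finSet d = M.finSet c) (n := c) ⟨hc, rfl⟩
  exact ⟨d, h₃, ⟨h₁, fun x hx hx' h => h₄ x hx ⟨hx', h.trans h₂⟩⟩, h₂⟩

theorem IsFinCode.le {c d : M.N} (hc : M.IsFinCode c) (hd : M.IsTriple d)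
    (h : M.finSet d = M.finSet c) : c ≤ d :=
  not_lt.1 fun hlt => hc.2 d hlt hd h

theorem IsFinCode.eq {c d : M.N} (hc : M.IsFinCode c) (hd : M.IsFinCode d)
    (h : M.finSet c = M.finSet d) : c = d :=
  le_antisymm (hc.le hd.1 h.symm) (hd.le hc.1 h)

/-! ### Gödel's moduli and the existence of codes. -/

theorem exists_forall_dvd (b : M.N) : ∃ m : M.N, 0 < m ∧ ∀ i, i < b → i + 1 ∣ m := by
  refine induction_exists (fun m b => 0 < m ∧ ∀ i, i < b → i + 1 ∣ m)
    ⟨1, zero_lt_one, fun i hi => (not_lt_zero hi).elim⟩ (fun b ⟨m, hm, h⟩ => ?_) b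
  refine ⟨m * (b + 1), mul_pos hm (lt_add_one_iff.2 zero_le), fun i hi => ?_⟩
  rcases (lt_add_one_iff.1 hi).lt_or_eq with hi | rfl
  exacts [(h i hi).mul_right _, dvd_mul_left _ _]

theorem exists_forall_modulus_dvd (m b : M.N) :
    ∃ D : M.N, 0 < D ∧ ∀ i, i < b → m * (i + 1) + 1 ∣ D := by
  refine induction_exists (fun D b => 0 < D ∧ ∀ i, i < b → m * (i + 1) + 1 ∣ D)
    ⟨1, zero_lt_one, fun i hi => (not_lt_zero hi).elim⟩ (fun b ⟨D, hD, h⟩ => ?_) b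
  refine ⟨D * (m * (b + 1) + 1), mul_pos hD (lt_add_one_iff.2 zero_le), fun i hi => ?_⟩
  rcases (lt_add_one_iff.1 hi).lt_or_eq with hi | rfl
  exacts [(h i hi).mul_right _, dvd_mul_left _ _]

/-- The moduli `m(i + 1) + 1` and `m(j + 1) + 1` are coprime. -/
theorem modulus_dvd_of_dvd_mul {m b n i j : M.N} (hm : ∀ i, i < b → i + 1 ∣ m) (hi : i < b)
    (hj : j < b) (hij : i ≠ j) (h : m * (i + 1) + 1 ∣ n * (m * (j + 1) + 1)) :
    m * (i + 1) + 1 ∣ n := by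
  -- Modulo `m(i + 1) + 1` the number `m(i + 1)` is `-1`, so its square is `1`.
  have key : m * (i + 1) + 1 ∣ n * (m * (i + 1)) * (m * (i + 1)) → m * (i + 1) + 1 ∣ n := by
    intro h'
    have h₁ : m * (i + 1) + 1 ∣ n * (m * (i + 1)) * (m * (i + 1)) + n * (m * (i + 1) + 1) :=
      dvd_add h' (dvd_mul_left _ _)
    have h₂ : n * (m * (i + 1)) * (m * (i + 1)) + n * (m * (i + 1) + 1) =
      n * (m * (i + 1)) * (m * (i + 1) + 1) + n := by ring
    rw [h₂] at h₁
    exact dvd_of_dvd_add h₁ (dvd_mul_left _ _)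
  rcases hij.lt_or_gt with hij | hij
  · obtain ⟨t, rfl⟩ := lt_iff_exists_add_one.1 hij
    -- The two moduli differ by `m(t + 1)`, so the modulus of `i` divides `nm(t + 1)`. Since `m = (t
    -- + 1)r`, the factor `r(i + 1)²` turns this into `n(m(i + 1))²`.
    obtain ⟨r, rfl⟩ := hm t (lt_of_le_of_lt (le_add_self.trans le_self_add) hj)
    refine key (dvd_of_dvd_add (b := n * ((t + 1) * r * (i + 1) + 1) * (r * (i + 1) * (i + 1)))
      ?_ ⟨n * (r * (i + 1) * (i + 1)), by ring⟩)
    exact (h.mul_right (r * (i + 1) * (i + 1))).trans (dvd_of_eq (by ring))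
  · obtain ⟨t, rfl⟩ := lt_iff_exists_add_one.1 hij
    obtain ⟨r, rfl⟩ := hm t (lt_of_le_of_lt (le_add_self.trans le_self_add) hi)
    refine key (dvd_of_dvd_add (b := n * ((t + 1) * r * (j + 1) + 1) *
      (r * (j + t + 1 + 1) * (j + t + 1 + 1))) ?_ (h.mul_right _))
    exact ⟨n * (r * (j + t + 1 + 1) * (j + t + 1 + 1)), by ring⟩

/-- The number `n` is the product of the moduli of those `i` with `R i`. It is built along a
factorization `D = n * w` in which `w` keeps all moduli not yet treated; if `R k`, the modulus of
`k` moves from `w` to `n`. Coprimality protects the other moduli, and both factors are at most `D`,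
so the induction is on a bounded property. -/
theorem exists_forall_modulus_dvd_iff {m b D : M.N} (hm₀ : 0 < m)
    (hm : ∀ i, i < b → i + 1 ∣ m) (hD₀ : 0 < D) (hD : ∀ i, i < b → m * (i + 1) + 1 ∣ D)
    (R : M.N → Prop) (h : Bdd M (fun e => R (e 0)) := by infer_instance) :
    ∃ n, n ≤ D ∧ ∀ i, i < b → (m * (i + 1) + 1 ∣ n ↔ R i) := by
  have := @Bdd.comp₁ M R h
  have key := induction_bdd (fun k : M.N => k ≤ b →
    ∃ n : M.N, n < D + 1 ∧ ∃ w : M.N, w < D + 1 ∧ n * w = D ∧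
    (∀ i : M.N, i < b → (m * (i + 1) + 1 ∣ n ↔ i < k ∧ R i)) ∧
    ∀ i : M.N, i < b → k ≤ i → m * (i + 1) + 1 ∣ w) (fun _ => ?_) (fun k ih hk => ?_) b
  · obtain ⟨n, hn, _, _, _, h, _⟩ := key le_rfl
    exact ⟨n, lt_add_one_iff.1 hn, fun i hi => (h i hi).trans (and_iff_right hi)⟩
  -- The empty product is `1`, which no modulus divides, since `0 < m` makes each modulus exceed
  -- `1`.
  · refine ⟨1, ?_, D, ?_, one_mul D, fun i hi => iff_of_false (fun hd => ?_) (fun h => ?_),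
      fun i hi _ => hD i hi⟩
    · exact lt_add_one_iff.2 (by simpa using add_one_le_iff.2 hD₀)
    · exact lt_add_one_iff.2 le_rfl
    · obtain ⟨q, hq⟩ := hd
      have hq₀ : 0 < q := by
        rcases eq_zero_or_pos q with rfl | h
        · simp at hq
        · exact h
      have h₁ : m * (i + 1) + 1 ≤ 1 := by
        conv_rhs => rw [hq, mul_comm]
        exact le_mul_of_pos hq₀
      have h₂ : 0 < m * (i + 1) := mul_pos hm₀ (lt_add_one_iff.2 zero_le)
      exact absurd h₁ (not_le.2 (by simpa using h₂))
    · exact not_lt_zero h.1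
  · obtain ⟨n, hn, w, hw, hnw, h₁, h₂⟩ := ih (le_self_add.trans hk)
    have hkb : k < b := add_one_le_iff.1 hk
    by_cases hR : R k
    · obtain ⟨w', rfl⟩ := h₂ k hkb le_rfl
      have hle : ∀ {x y : M.N}, x * y = D → x < D + 1 ∧ y < D + 1 := by
        intro x y hxy
        have hx : 0 < x := by
          rcases eq_zero_or_pos x with rfl | h
          · simp [← hxy] at hD₀
          · exact h
        have hy : 0 < y := by
          rcases eq_zero_or_pos y with rfl | h
          · simp [← hxy] at hD₀
          · exact h
        exact ⟨lt_add_one_iff.2 (by rw [← hxy, mul_comm]; exact le_mul_of_pos hy),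
          lt_add_one_iff.2 (by rw [← hxy]; exact le_mul_of_pos hx)⟩
      have hnw' : n * (m * (k + 1) + 1) * w' = D := by rw [mul_assoc, hnw]
      refine ⟨n * (m * (k + 1) + 1), (hle hnw').1, w', (hle hnw').2, hnw', fun i hi => ?_,
        fun i hi hki => ?_⟩
      · by_cases hik : i = k
        · subst hik
          exact iff_of_true (dvd_mul_left _ _) ⟨lt_add_one_iff.2 le_rfl, hR⟩
        · have : i < k + 1 ↔ i < k := by
            rw [lt_add_one_iff, le_iff_lt_or_eq, or_iff_left hik]
          rw [this, ← h₁ i hi]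
          exact ⟨modulus_dvd_of_dvd_mul hm hi hkb hik, fun h => h.mul_right _⟩
      · have hki := add_one_le_iff.1 hki
        refine modulus_dvd_of_dvd_mul hm hi hkb hki.ne' ?_
        rw [mul_comm w']
        exact h₂ i hi hki.le
    · refine ⟨n, hn, w, hw, hnw, fun i hi => (h₁ i hi).trans ?_,
        fun i hi hki => h₂ i hi (le_self_add.trans hki)⟩
      rw [lt_add_one_iff]
      constructor
      · exact fun h => ⟨h.1.le, h.2⟩
      · refine fun h => ⟨h.1.lt_of_ne ?_, h.2⟩
        rintro rfl
        exact hR h.2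

/-- `U` exceeds the codes of all finite sets of numbers below `b`, as witnessed by moduli. -/
def CodeBound (M : L2Structure.{u}) (b U : M.N) : Prop :=
  ∃ m, m < U ∧ ∃ D, D < U ∧ U = M.pair b (M.pair m D) + 1 ∧ 0 < m ∧
    (∀ i, i < b → ∃ q, q < m + 1 ∧ m = (i + 1) * q) ∧ 0 < D ∧
    ∀ i, i < b → ∃ q, q < D + 1 ∧ D = (m * (i + 1) + 1) * q

instance Bdd.codeBound {s t : (ℕ → M.N) → M.N} [Tm M s] [Tm M t] :
    Bdd M (fun e => M.CodeBound (s e) (t e)) := by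
  have h : Bdd M (fun e => M.CodeBound (e 0) (e 1)) := by
    unfold CodeBound
    infer_instance
  exact h.comp₂ (R := M.CodeBound)

theorem exists_codeBound (b : M.N) : ∃ U, M.CodeBound b U := by
  obtain ⟨m, hm₀, hm⟩ := exists_forall_dvd b
  obtain ⟨D, hD₀, hD⟩ := exists_forall_modulus_dvd m b
  refine ⟨M.pair b (M.pair m D) + 1, m, ?_, D, ?_, rfl, hm₀,
    fun i hi => dvd_iff_exists_lt.1 (hm i hi), hD₀, fun i hi => dvd_iff_exists_lt.1 (hD i hi)⟩
  · exact lt_add_one_iff.2 ((left_le_pair _ _).trans (right_le_pair _ _))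
  · exact lt_add_one_iff.2 ((right_le_pair _ _).trans (right_le_pair _ _))

/-- The triple `(b, (m, n))` with `n ≤ D` is below `U` by monotonicity of pairing, and passing to
the least triple for the same set only lowers it. -/
theorem CodeBound.exists_isFinCode {b U : M.N} (hU : M.CodeBound b U) (R : M.N → Prop)
    (h : Bdd M (fun e => R (e 0)) := by infer_instance) :
    ∃ c, c < U ∧ M.IsFinCode c ∧ ∀ i, i ∈ M.finSet c ↔ i < b ∧ R i := by
  obtain ⟨m, _, D, _, rfl, hm₀, hm, hD₀, hD⟩ := hU
  obtain ⟨n, hn, h⟩ := exists_forall_modulus_dvd_iff hm₀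
    (fun i hi => dvd_iff_exists_lt.2 (hm i hi)) hD₀ (fun i hi => dvd_iff_exists_lt.2 (hD i hi)) R
  obtain ⟨c, hc, hc', hcs⟩ := exists_isFinCode_le (M := M) ⟨b, m, n, rfl⟩
  refine ⟨c, lt_add_one_iff.2 (hc.trans (pair_le_pair le_rfl (pair_le_pair le_rfl hn))), hc',
    fun i => ?_⟩
  rw [hcs, mem_finSet_pair]
  exact and_congr_right fun hi => h i hi

theorem CodeBound.lt {b U c : M.N} (hU : M.CodeBound b U) (hc : M.IsFinCode c)
    (hb : ∀ i ∈ M.finSet c, i < b) : c < U := by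
  obtain ⟨d, hd, hd', h⟩ := hU.exists_isFinCode (fun i => i ∈ M.finSet c)
  rwa [hc.eq hd' (Set.ext fun i => (iff_and_self.2 (hb i)).trans (h i).symm)]

/-! ### Binary sequences -/

theorem left_lt_of_pair_mem {i j c : M.N} (h : M.pair i j ∈ M.finSet c) : i < c :=
  (left_le_pair _ _).trans_lt (lt_of_mem_finSet h)

theorem right_lt_of_pair_mem {i j c : M.N} (h : M.pair i j ∈ M.finSet c) : j < c :=
  (right_le_pair _ _).trans_lt (lt_of_mem_finSet h)

theorem seq_length_le {l s : M.N} (h : M.IsSeq l s) : l ≤ s := by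
  rcases hM.out.eq_zero_or_succ l with rfl | ⟨k, rfl⟩
  · exact zero_le
  · obtain ⟨j, hj⟩ := (h.2.2.2 k).1 (lt_add_one_iff.2 le_rfl)
    exact add_one_le_iff.2 ((left_le_pair _ _).trans_lt (lt_of_mem_finSet hj))

/-- All indices and entries are below the code `s`. The clause `l < s + 1` ensures that the test of
indices below `s` covers all indices below `l`. -/
theorem isSeq_iff {l s : M.N} : M.IsSeq l s ↔ M.IsFinCode s ∧
    (∀ n, n < s → n ∈ M.finSet s → ∃ i, i < s ∧ ∃ j, j < s ∧ n = M.pair i j) ∧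
    (∀ i, i < s → ∀ j, j < s → ∀ j', j' < s → M.pair i j ∈ M.finSet s →
      M.pair i j' ∈ M.finSet s → j = j') ∧
    l < s + 1 ∧ ∀ i, i < s → (i < l ↔ ∃ j, j < s ∧ M.pair i j ∈ M.finSet s) := by
  constructor
  · refine fun h => ⟨h.1, fun n _ hn => ?_, fun i _ j _ j' _ => h.2.2.1 i j j',
      lt_add_one_iff.2 (seq_length_le h), fun i _ => (h.2.2.2 i).trans
        ⟨fun ⟨j, hj⟩ => ⟨j, right_lt_of_pair_mem hj, hj⟩, fun ⟨j, _, hj⟩ => ⟨j, hj⟩⟩⟩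
    obtain ⟨i, j, rfl⟩ := h.2.1 n hn
    exact ⟨i, left_lt_of_pair_mem hn, j, right_lt_of_pair_mem hn, rfl⟩
  · rintro ⟨h₁, h₂, h₃, h₄, h₅⟩
    refine ⟨h₁, fun n hn => ?_, fun i j j' h h' => h₃ i (left_lt_of_pair_mem h) j
      (right_lt_of_pair_mem h) j' (right_lt_of_pair_mem h') h h',
      fun i => ⟨fun hi => ?_, fun ⟨j, hj⟩ => ?_⟩⟩
    · obtain ⟨i, _, j, _, h⟩ := h₂ n (lt_of_mem_finSet hn) hn
      exact ⟨i, j, h⟩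
    · obtain ⟨j, _, hj⟩ := (h₅ i (hi.trans_le (lt_add_one_iff.1 h₄))).1 hi
      exact ⟨j, hj⟩
    · exact (h₅ i (left_lt_of_pair_mem hj)).2 ⟨j, right_lt_of_pair_mem hj, hj⟩

instance Bdd.isSeq {s t : (ℕ → M.N) → M.N} [Tm M s] [Tm M t] :
    Bdd M (fun e => M.IsSeq (s e) (t e)) := by
  have h : Bdd M (fun e => M.IsSeq (e 0) (e 1)) := by
    simp only [isSeq_iff]
    infer_instance
  exact h.comp₂ (R := M.IsSeq)

theorem isBinSeq_iff {s : M.N} : M.IsBinSeq s ↔ (∃ l, l < s + 1 ∧ M.IsSeq l s) ∧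
    ∀ i, i < s → ∀ j, j < s → M.pair i j ∈ M.finSet s → j = 0 ∨ j = 1 := by
  refine and_congr (exists_congr fun l => ?_) ⟨fun h i _ j _ => h i j, fun h i j hij => ?_⟩
  · exact (and_iff_right_of_imp fun h => lt_add_one_iff.2 (seq_length_le h)).symm
  · exact h i (left_lt_of_pair_mem hij) j (right_lt_of_pair_mem hij) hij

instance Bdd.isBinSeq {t : (ℕ → M.N) → M.N} [Tm M t] : Bdd M (fun e => M.IsBinSeq (t e)) := by
  have h : Bdd M (fun e => M.IsBinSeq (e 0)) := by
    simp only [isBinSeq_iff]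
    infer_instance
  exact h.comp₁ (R := M.IsBinSeq)

theorem IsBinSeq.lt_pair {l s n : M.N} (hs : M.IsBinSeq s) (hl : M.IsSeq l s)
    (hn : n ∈ M.finSet s) : n < M.pair l 1 := by
  obtain ⟨i, j, rfl⟩ := hl.2.1 n hn
  refine pair_lt_pair_left ((hl.2.2.2 i).2 ⟨j, hn⟩) ?_
  rcases hs.2 i j hn with rfl | rfl
  exacts [zero_le, le_rfl]

/-- Through this bound, a search through the binary sequences of length `l` is a bounded quantifier.
-/
theorem IsBinSeq.lt_of_codeBound {l s U : M.N} (hs : M.IsBinSeq s) (hl : M.IsSeq l s)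
    (hU : M.CodeBound (M.pair l 1) U) : s < U :=
  hU.lt hl.1 fun _ hi => hs.lt_pair hl hi

/-- Every bounded quantifier property restricted to the numbers below `l` is the characteristic
function of a binary sequence of length `l`. -/
theorem exists_binSeq (l : M.N) (R : M.N → Prop)
    (h : Bdd M (fun e => R (e 0)) := by infer_instance) :
    ∃ s, M.IsSeq l s ∧ M.IsBinSeq s ∧
      ∀ i j, M.pair i j ∈ M.finSet s ↔ i < l ∧ (j = 1 ∧ R i ∨ j = 0 ∧ ¬ R i) := by
  have := @Bdd.comp₁ M R h
  obtain ⟨U, hU⟩ := exists_codeBound (M.pair l 1)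
  obtain ⟨s, -, hs, hsR⟩ := hU.exists_isFinCode
    (fun n => ∃ i, i < l ∧ (n = M.pair i 1 ∧ R i ∨ n = M.pair i 0 ∧ ¬ R i))
  have key : ∀ i j, M.pair i j ∈ M.finSet s ↔ i < l ∧ (j = 1 ∧ R i ∨ j = 0 ∧ ¬ R i) := by
    intro i j
    rw [hsR]
    constructor
    · rintro ⟨_, i', hi', ⟨h₁, h₂⟩ | ⟨h₁, h₂⟩⟩ <;> obtain ⟨rfl, rfl⟩ := pair_inj.1 h₁
      exacts [⟨hi', .inl ⟨rfl, h₂⟩⟩, ⟨hi', .inr ⟨rfl, h₂⟩⟩]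
    · rintro ⟨hi, ⟨rfl, hR⟩ | ⟨rfl, hR⟩⟩
      · exact ⟨pair_lt_pair_left hi le_rfl, i, hi, .inl ⟨rfl, hR⟩⟩
      · exact ⟨pair_lt_pair_left hi zero_le, i, hi, .inr ⟨rfl, hR⟩⟩
  have hseq : M.IsSeq l s := by
    refine ⟨hs, fun n hn => ?_, fun i j j' h h' => ?_, fun i => ⟨fun hi => ?_, ?_⟩⟩
    · obtain ⟨_, i, _, ⟨h, _⟩ | ⟨h, _⟩⟩ := (hsR n).1 hn
      exacts [⟨i, _, h⟩, ⟨i, _, h⟩]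
    · rcases ((key i j).1 h).2 with ⟨rfl, h₁⟩ | ⟨rfl, h₁⟩ <;>
        rcases ((key i j').1 h').2 with ⟨rfl, h₂⟩ | ⟨rfl, h₂⟩
      exacts [rfl, (h₂ h₁).elim, (h₁ h₂).elim, rfl]
    · by_cases hR : R i
      exacts [⟨1, (key i 1).2 ⟨hi, .inl ⟨rfl, hR⟩⟩⟩, ⟨0, (key i 0).2 ⟨hi, .inr ⟨rfl, hR⟩⟩⟩]
    · rintro ⟨j, hj⟩
      exact ((key i j).1 hj).1
  refine ⟨s, hseq, ⟨⟨l, hseq⟩, fun i j hij => ?_⟩, key⟩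
  rcases ((key i j).1 hij).2 with ⟨h, _⟩ | ⟨h, _⟩
  exacts [.inr h, .inl h]

theorem IsBinSeq.pair_zero_mem_iff {l s i : M.N} (hs : M.IsBinSeq s) (hl : M.IsSeq l s)
    (hi : i < l) : M.pair i 0 ∈ M.finSet s ↔ M.pair i 1 ∉ M.finSet s := by
  constructor
  · exact fun h h' => zero_ne_one (hl.2.2.1 i 0 1 h h')
  · intro h
    obtain ⟨j, hj⟩ := (hl.2.2.2 i).1 hi
    rcases hs.2 i j hj with rfl | rfl
    exacts [hj, (h hj).elim]

/-! ### From weak König's lemma to embeddings. -/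

theorem IsFunction.pair_mem_unique {f X Y : Set M.N} (hf : M.IsFunction f X Y) {x y y' : M.N}
    (h : M.pair x y ∈ f) (h' : M.pair x y' ∈ f) : y = y' :=
  (hf.2.2 x (pair_mem_prod.1 (hf.2.1 h)).1).unique h h'

/-- The preimage is `Δ⁰₁`: as `x` has exactly one image, some image lies in `J` if and only if every
image does. -/
theorem preimage_mem_initialIntervals {Q RQ P RP f J : Set M.N} (hQ : M.IsPartialOrder Q RQ)
    (hf : M.IsEmbedding f Q RQ P RP) (hJ : J ∈ M.initialIntervals P RP) :
    M.preimage f Q J ∈ M.initialIntervals Q RQ := by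
  obtain ⟨hJS, hJP, hJ⟩ := hJ
  obtain ⟨hf, hle⟩ := hf
  have : Fact (J ∈ M.S) := ⟨hJS⟩
  have : Fact (Q ∈ M.S) := ⟨hQ.mem_carrier⟩
  have : Fact (f ∈ M.S) := ⟨hf.1⟩
  refine ⟨?_, fun x hx => hx.1, fun x hx y hy hxy ⟨_, z, hz, hyz⟩ => ?_⟩
  · have := setOf_exists_mem (fun y x => x ∈ Q ∧ y ∈ J ∧ M.pair x y ∈ f)
      (fun y x => x ∈ Q ∧ (M.pair x y ∈ f → y ∈ J)) (fun x => ?_)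
    · convert this using 1
      ext x
      simp [preimage]
    · constructor
      · rintro ⟨y, hx, hy, hxy⟩ z
        exact ⟨hx, fun hz => hf.pair_mem_unique hxy hz ▸ hy⟩
      · intro h
        obtain ⟨y, hy, _⟩ := hf.2.2 x (h 0).1
        exact ⟨y, (h 0).1, (h y).2 hy, hy⟩
  · obtain ⟨w, hw, _⟩ := hf.2.2 x hx
    exact ⟨hx, w, hJ w (pair_mem_prod.1 (hf.2.1 hw)).2 z (hJP hz)
      ((hle x hx y hy w z hw hyz).1 hxy) hz, hw⟩

/-- The tree of the binary sequences that are, so far, characteristic functions of initial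
intervals of `P` whose preimage under `f` is `I`. -/
def intervalTree (M : L2Structure.{u}) (Q P RP f I : Set M.N) : Set M.N :=
  {s | M.IsBinSeq s ∧ (∀ y, M.pair y 1 ∈ M.finSet s → y ∈ P) ∧
    (∀ x y, M.pair y 1 ∈ M.finSet s → M.pair x 0 ∈ M.finSet s → M.pair x y ∉ RP) ∧
    ∀ x y j j', M.pair x j ∈ M.finSet s → M.pair y j' ∈ M.finSet s → M.pair x y ∈ f → x ∈ Q →
      (x ∈ I → j' = 1) ∧ (x ∉ I → j' = 0)}

theorem intervalTree_mem {Q P RP f I : Set M.N} (hQ : Q ∈ M.S) (hP : P ∈ M.S) (hR : RP ∈ M.S)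
    (hf : f ∈ M.S) (hI : I ∈ M.S) : M.intervalTree Q P RP f I ∈ M.S := by
  have : Fact (Q ∈ M.S) := ⟨hQ⟩
  have : Fact (P ∈ M.S) := ⟨hP⟩
  have : Fact (RP ∈ M.S) := ⟨hR⟩
  have : Fact (f ∈ M.S) := ⟨hf⟩
  have : Fact (I ∈ M.S) := ⟨hI⟩
  convert setOf_mem (fun s => M.IsBinSeq s ∧
    (∀ y, y < s → M.pair y 1 ∈ M.finSet s → y ∈ P) ∧
    (∀ x, x < s → ∀ y, y < s → M.pair y 1 ∈ M.finSet s → M.pair x 0 ∈ M.finSet s →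
      ¬ M.pair x y ∈ RP) ∧
    ∀ x, x < s → ∀ y, y < s → ∀ j, j < s → ∀ j', j' < s → M.pair x j ∈ M.finSet s →
      M.pair y j' ∈ M.finSet s → M.pair x y ∈ f → x ∈ Q →
      (x ∈ I → j' = 1) ∧ (¬ x ∈ I → j' = 0)) using 1
  ext s
  refine and_congr_right fun _ => and_congr ?_ (and_congr ?_ ?_)
  · exact ⟨fun h y _ => h y, fun h y hy => h y (left_lt_of_pair_mem hy) hy⟩
  · exact ⟨fun h x _ y _ => h x y, fun h x y hy hx =>
      h x (left_lt_of_pair_mem hx) y (left_lt_of_pair_mem hy) hy hx⟩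
  · exact ⟨fun h x _ y _ j _ j' _ => h x y j j', fun h x y j j' hx hy =>
      h x (left_lt_of_pair_mem hx) y (left_lt_of_pair_mem hy) j (right_lt_of_pair_mem hx) j'
        (right_lt_of_pair_mem hy) hx hy⟩

theorem isBinTree_intervalTree {Q P RP f I : Set M.N} (hQ : Q ∈ M.S) (hP : P ∈ M.S)
    (hR : RP ∈ M.S) (hf : f ∈ M.S) (hI : I ∈ M.S) : M.IsBinTree (M.intervalTree Q P RP f I) := by
  refine ⟨intervalTree_mem hQ hP hR hf hI, fun t ht => ht.1, fun t ht s hs hst => ?_⟩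
  obtain ⟨_, h₁, h₂, h₃⟩ := ht
  exact ⟨hs, fun y hy => h₁ y (hst hy), fun x y hy hx => h₂ x y (hst hy) (hst hx),
    fun x y j j' hx hy => h₃ x y j j' (hst hx) (hst hy)⟩

/-- For length `k + 1`, take the part below `k + 1` of the downward closure of those values `f(x) ≤
k` with `x ≤ k` in `I`. This is a bounded property, and it suffices because the tree conditions
mention only indices of the sequence. -/
theorem isInfinite_intervalTree {Q RQ P RP f I : Set M.N} (hP : M.IsPartialOrder P RP)
    (hf : M.IsEmbedding f Q RQ P RP) (hI : I ∈ M.initialIntervals Q RQ) :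
    M.IsInfinite (M.intervalTree Q P RP f I) := by
  obtain ⟨hIS, hIQ, hI⟩ := hI
  obtain ⟨hf, hle⟩ := hf
  intro k
  have : Fact (I ∈ M.S) := ⟨hIS⟩
  have : Fact (P ∈ M.S) := ⟨hP.mem_carrier⟩
  have : Fact (RP ∈ M.S) := ⟨hP.mem_rel⟩
  have : Fact (f ∈ M.S) := ⟨hf.1⟩
  have hfP : ∀ {x y}, M.pair x y ∈ f → y ∈ P := fun h => (pair_mem_prod.1 (hf.2.1 h)).2
  obtain ⟨s, hl, hs, h⟩ := exists_binSeq (k + 1) (fun y => y ∈ P ∧ ∃ x, x < k + 1 ∧ x ∈ I ∧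
    ∃ z, z < k + 1 ∧ M.pair x z ∈ f ∧ M.pair y z ∈ RP)
  have h1 : ∀ i, M.pair i 1 ∈ M.finSet s ↔ i < k + 1 ∧ i ∈ P ∧ ∃ x, x < k + 1 ∧ x ∈ I ∧
      ∃ z, z < k + 1 ∧ M.pair x z ∈ f ∧ M.pair i z ∈ RP := by
    intro i
    rw [h]
    simp
  have hlt : ∀ {i j}, M.pair i j ∈ M.finSet s → i < k + 1 := fun hi => ((h _ _).1 hi).1
  refine ⟨s, ⟨hs, fun y hy => ((h1 y).1 hy).2.1, fun x y hy hx hxy => ?_,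
    fun x y j j' hx hy hxy hxQ => ⟨fun hxI => ?_, fun hxI => ?_⟩⟩,
    add_one_le_iff.1 (seq_length_le hl)⟩
  · refine (hs.pair_zero_mem_iff hl (hlt hx)).1 hx ((h1 x).2 ⟨hlt hx, ?_⟩)
    obtain ⟨_, hyP, w, hw, hwI, z, hz, hwz, hyz⟩ := (h1 y).1 hy
    have hxP := (pair_mem_prod.1 (hP.rel_subset hxy)).1
    exact ⟨hxP, w, hw, hwI, z, hz, hwz, hP.trans x hxP y hyP z (hfP hwz) hxy hyz⟩
  · rcases hs.2 _ _ hy with rfl | rfl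
    · refine ((hs.pair_zero_mem_iff hl (hlt hy)).1 hy ((h1 y).2 ⟨hlt hy, hfP hxy, x, hlt hx, hxI,
        y, hlt hy, hxy, hP.refl y (hfP hxy)⟩)).elim
    · rfl
  · rcases hs.2 _ _ hy with rfl | rfl
    · rfl
    · obtain ⟨_, _, w, _, hwI, z, _, hwz, hyz⟩ := (h1 y).1 hy
      -- From `f(x) = y ≼ z = f(w)` with `w ∈ I`, the embedding gives `x ≼ w`, and so `x ∈ I`.
      exact (hxI (hI x hxQ w (hIQ hwI) ((hle x hxQ w (hIQ hwI) y z hxy hwz).2 hyz) hwI)).elim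

theorem embeddingStatement_of_weakKonig (hW : M.WeakKonig) : M.EmbeddingStatement := by
  intro Q RQ P RP f hQ hP hf
  ext I
  refine ⟨fun hI => ?_, fun ⟨J, hJ, h⟩ => h ▸ preimage_mem_initialIntervals hQ hf hJ⟩
  obtain ⟨g, hg, hpath⟩ := hW _
    (isBinTree_intervalTree hQ.mem_carrier hP.mem_carrier hP.mem_rel hf.1.1 hI.1)
    (isInfinite_intervalTree hP hf hI)
  -- Each condition to be checked concerns at most two numbers, so the restriction of the path to
  -- length `x + y + 1` decides it.
  have key : ∀ x y, ∃ s ∈ M.intervalTree Q P RP f I, ∃ n, M.IsSeq n s ∧ x < n ∧ y < n ∧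
      (∀ j, M.pair x j ∈ M.finSet s ↔ M.pair x j ∈ g) ∧
      ∀ j, M.pair y j ∈ M.finSet s ↔ M.pair y j ∈ g := by
    intro x y
    obtain ⟨s, hs, hl, h⟩ := hpath (x + y + 1)
    have hx : x < x + y + 1 := lt_add_one_iff.2 le_self_add
    have hy : y < x + y + 1 := lt_add_one_iff.2 le_add_self
    exact ⟨s, hs, _, hl, hx, hy, h x hx, h y hy⟩
  have : Fact (g ∈ M.S) := ⟨hg.1⟩
  refine ⟨{y | M.pair y 1 ∈ g}, ⟨setOf_mem (fun y => M.pair y 1 ∈ g), fun y hy => ?_,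
    fun x hx y hy hxy hyg => ?_⟩, Set.ext fun x => ⟨fun hx => ?_, ?_⟩⟩
  · obtain ⟨s, hs, _, _, _, _, h, _⟩ := key y y
    exact hs.2.1 y ((h 1).2 hy)
  · obtain ⟨s, hs, n, hl, hxn, hyn, h, h'⟩ := key x y
    by_contra hxg
    refine hs.2.2.1 x y ((h' 1).2 hyg) ((hs.1.pair_zero_mem_iff hl hxn).2 fun h₁ => ?_) hxy
    exact hxg ((h 1).1 h₁)
  · have hxQ := hI.2.1 hx
    obtain ⟨y, hy, _⟩ := hf.1.2.2 x hxQ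
    refine ⟨hxQ, y, ?_, hy⟩
    obtain ⟨s, hs, n, hl, hxn, hyn, h, h'⟩ := key x y
    obtain ⟨j, hj⟩ := (hl.2.2.2 x).1 hxn
    obtain ⟨j', hj'⟩ := (hl.2.2.2 y).1 hyn
    obtain rfl := (hs.2.2.2 x y j j' hj hj' hy hxQ).1 hx
    exact (h' 1).1 hj'
  · rintro ⟨hxQ, y, hyg, hy⟩
    by_contra hx
    obtain ⟨s, hs, n, hl, hxn, hyn, h, h'⟩ := key x y
    obtain ⟨j, hj⟩ := (hl.2.2.2 x).1 hxn
    exact one_ne_zero ((hs.2.2.2 x y j 1 hj ((h' 1).2 hyg) hy hxQ).2 hx)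

/-! ### From embeddings to subsets. -/

theorem prod_mem {X Y : Set M.N} (hX : X ∈ M.S) (hY : Y ∈ M.S) : M.prod X Y ∈ M.S := by
  have : Fact (X ∈ M.S) := ⟨hX⟩
  have : Fact (Y ∈ M.S) := ⟨hY⟩
  convert setOf_mem (fun n => ∃ i, i < n + 1 ∧ i ∈ X ∧ ∃ j, j < n + 1 ∧ j ∈ Y ∧ n = M.pair i j)
    using 1
  ext n
  constructor
  · rintro ⟨i, hi, j, hj, rfl⟩
    exact ⟨i, lt_add_one_iff.2 (left_le_pair _ _), hi, j, lt_add_one_iff.2 (right_le_pair _ _),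
      hj, rfl⟩
  · rintro ⟨i, _, hi, j, _, hj, rfl⟩
    exact ⟨i, hi, j, hj, rfl⟩

theorem IsPartialOrder.restrict {P R Q : Set M.N} (h : M.IsPartialOrder P R) (hQ : Q ∈ M.S)
    (hQP : Q ⊆ P) : M.IsPartialOrder Q (R ∩ M.prod Q Q) where
  mem_carrier := hQ
  mem_rel := by
    have : Fact (R ∈ M.S) := ⟨h.mem_rel⟩
    have : Fact (M.prod Q Q ∈ M.S) := ⟨prod_mem hQ hQ⟩
    exact setOf_mem (fun n => n ∈ R ∧ n ∈ M.prod Q Q)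
  rel_subset := Set.inter_subset_right
  refl x hx := ⟨h.refl x (hQP hx), pair_mem_prod.2 ⟨hx, hx⟩⟩
  antisymm x hx y hy hxy hyx := h.antisymm x (hQP hx) y (hQP hy) hxy.1 hyx.1
  trans x hx y hy z hz hxy hyz :=
    ⟨h.trans x (hQP hx) y (hQP hy) z (hQP hz) hxy.1 hyz.1, pair_mem_prod.2 ⟨hx, hz⟩⟩

theorem exists_inclusion {P R Q : Set M.N} (hQ : Q ∈ M.S) (hQP : Q ⊆ P) :
    ∃ f, M.IsEmbedding f Q (R ∩ M.prod Q Q) P R ∧ ∀ J, M.preimage f Q J = J ∩ Q := by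
  have : Fact (Q ∈ M.S) := ⟨hQ⟩
  have hmem : ∀ x y, M.pair x y ∈ {n | ∃ i, i < n + 1 ∧ i ∈ Q ∧ n = M.pair i i} ↔
      x ∈ Q ∧ x = y := by
    intro x y
    constructor
    · rintro ⟨i, _, hi, h⟩
      obtain ⟨rfl, rfl⟩ := pair_inj.1 h
      exact ⟨hi, rfl⟩
    · rintro ⟨hx, rfl⟩
      exact ⟨x, lt_add_one_iff.2 (left_le_pair _ _), hx, rfl⟩
  refine ⟨{n | ∃ i, i < n + 1 ∧ i ∈ Q ∧ n = M.pair i i}, ⟨⟨?_, ?_, fun i hi => ?_⟩, ?_⟩, ?_⟩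
  · exact setOf_mem (fun n => ∃ i, i < n + 1 ∧ i ∈ Q ∧ n = M.pair i i)
  · rintro n ⟨i, _, hi, rfl⟩
    exact pair_mem_prod.2 ⟨hi, hQP hi⟩
  · exact ⟨i, (hmem i i).2 ⟨hi, rfl⟩, fun j hj => ((hmem i j).1 hj).2.symm⟩
  · intro x hx x' hx' y y' hy hy'
    obtain ⟨_, rfl⟩ := (hmem x y).1 hy
    obtain ⟨_, rfl⟩ := (hmem x' y').1 hy'
    exact ⟨fun h => h.1, fun h => ⟨h, pair_mem_prod.2 ⟨hx, hx'⟩⟩⟩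
  · intro J
    ext x
    constructor
    · rintro ⟨hx, y, hy, hxy⟩
      obtain ⟨_, rfl⟩ := (hmem x y).1 hxy
      exact ⟨hy, hx⟩
    · exact fun ⟨hJ, hx⟩ => ⟨hx, x, hJ, (hmem x x).2 ⟨hx, rfl⟩⟩

theorem subsetStatement_of_embeddingStatement (h : M.EmbeddingStatement) :
    M.SubsetStatement := by
  intro P R Q hP hQ hQP
  obtain ⟨f, hf, hpre⟩ := exists_inclusion (R := R) hQ hQP
  rw [h Q _ P R f (hP.restrict hQ hQP) hP hf]
  simp only [hpre]

/-! ### `Σ⁰₁` separation from initial intervals of suborders -/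

/-- The order with `n ≼ (n, k)` (tags `0` and `1`) if `A k n`, and `(n, k) ≼ n` (tags `2` and `0`)
if `B k n`. -/
def SeparationRel (M : L2Structure.{u}) (A B : M.N → M.N → Prop) (p q : M.N) : Prop :=
  p = q ∨ (∃ n k : M.N, p = M.pair n 0 ∧ q = M.pair (M.pair n k) 1 ∧ A k n) ∨
    ∃ n k : M.N, p = M.pair (M.pair n k) (1 + 1) ∧ q = M.pair n 0 ∧ B k n

theorem one_add_one_ne_zero : (1 + 1 : M.N) ≠ 0 := hM.out.succ_ne_zero 1

theorem one_add_one_ne_one : (1 + 1 : M.N) ≠ 1 := fun h =>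
  one_ne_zero (hM.out.succ_inj _ _ (h.trans (zero_add 1).symm))

/-- The only chain of two proper steps that the tags allow goes from a `B` witness through `n` to an
`A` witness, and disjointness of `A` and `B` rules it out. -/
theorem separationRel_trans {A B : M.N → M.N → Prop} (hAB : ∀ n k k', A k n → ¬ B k' n)
    {p q r : M.N} (h : M.SeparationRel A B p q) (h' : M.SeparationRel A B q r) :
    M.SeparationRel A B p r := by
  rcases h with rfl | ⟨n, k, rfl, rfl, h⟩ | ⟨n, k, rfl, rfl, h⟩
  · exact h'
  · rcases h' with rfl | ⟨n', k', h₁, _⟩ | ⟨n', k', h₁, _⟩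
    · exact .inr (.inl ⟨n, k, rfl, rfl, h⟩)
    · exact (one_ne_zero (pair_inj.1 h₁).2).elim
    · exact (one_add_one_ne_one (pair_inj.1 h₁).2.symm).elim
  · rcases h' with rfl | ⟨n', k', h₁, rfl, h₂⟩ | ⟨n', k', h₁, _⟩
    · exact .inr (.inr ⟨n, k, rfl, rfl, h⟩)
    · obtain rfl := (pair_inj.1 h₁).1
      exact (hAB _ _ _ h₂ h).elim
    · exact (one_add_one_ne_zero (pair_inj.1 h₁).2.symm).elim

theorem separationRel_antisymm {A B : M.N → M.N → Prop} {p q : M.N}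
    (h : M.SeparationRel A B p q) (h' : M.SeparationRel A B q p) : p = q := by
  rcases h with rfl | ⟨n, k, rfl, rfl, h⟩ | ⟨n, k, rfl, rfl, h⟩
  · rfl
  · rcases h' with h₁ | ⟨n', k', h₁, _⟩ | ⟨n', k', h₁, _⟩
    · exact h₁.symm
    · exact (one_ne_zero (pair_inj.1 h₁).2).elim
    · exact (one_add_one_ne_one (pair_inj.1 h₁).2.symm).elim
  · rcases h' with h₁ | ⟨n', k', _, h₁, _⟩ | ⟨n', k', h₁, _⟩
    · exact h₁.symm
    · exact (one_add_one_ne_one (pair_inj.1 h₁).2).elim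
    · exact (one_add_one_ne_zero (pair_inj.1 h₁).2.symm).elim

theorem bdd_separationRel {A B : M.N → M.N → Prop} (hA : Bdd M (fun e => A (e 0) (e 1)))
    (hB : Bdd M (fun e => B (e 0) (e 1))) :
    Bdd M (fun e => M.SeparationRel A B (e 0) (e 1)) := by
  have := @Bdd.comp₂ M A hA
  have := @Bdd.comp₂ M B hB
  have key : Bdd M (fun e => e 0 = e 1 ∨
    (∃ n, n < e 1 + 1 ∧ ∃ k, k < e 1 + 1 ∧
      (e 0 = M.pair n 0 ∧ e 1 = M.pair (M.pair n k) 1 ∧ A k n)) ∨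
    ∃ n, n < e 0 + 1 ∧ ∃ k, k < e 0 + 1 ∧
      (e 0 = M.pair (M.pair n k) (1 + 1) ∧ e 1 = M.pair n 0 ∧ B k n)) := inferInstance
  refine key.congr fun e => or_congr_right (or_congr ⟨?_, ?_⟩ ⟨?_, ?_⟩)
  · rintro ⟨n, k, h₁, h₂, h⟩
    refine ⟨n, ?_, k, ?_, h₁, h₂, h⟩ <;> rw [lt_add_one_iff, h₂]
    exacts [(left_le_pair _ _).trans (left_le_pair _ _),
      (right_le_pair _ _).trans (left_le_pair _ _)]
  · rintro ⟨n, _, k, _, h⟩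
    exact ⟨n, k, h⟩
  · rintro ⟨n, k, h₁, h₂, h⟩
    refine ⟨n, ?_, k, ?_, h₁, h₂, h⟩ <;> rw [lt_add_one_iff, h₁]
    exacts [(left_le_pair _ _).trans (left_le_pair _ _),
      (right_le_pair _ _).trans (left_le_pair _ _)]
  · rintro ⟨n, _, k, _, h⟩
    exact ⟨n, k, h⟩

theorem univ_mem : (Set.univ : Set M.N) ∈ M.S := by
  simpa using setOf_mem (M := M) (fun n => n = n)

/-- The relation on numbers coded by the set of pairs `(p, q)` with `R p q`. -/
theorem setOf_pair_mem (R : M.N → M.N → Prop)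
    (h : Bdd M (fun e => R (e 0) (e 1)) := by infer_instance) :
    {n | ∃ p q, n = M.pair p q ∧ R p q} ∈ M.S := by
  have := @Bdd.comp₂ M R h
  convert setOf_mem (fun n => ∃ p, p < n + 1 ∧ ∃ q, q < n + 1 ∧ n = M.pair p q ∧ R p q) using 1
  ext n
  constructor
  · rintro ⟨p, q, rfl, h⟩
    exact ⟨p, lt_add_one_iff.2 (left_le_pair _ _), q, lt_add_one_iff.2 (right_le_pair _ _), rfl, h⟩
  · rintro ⟨p, _, q, _, h⟩
    exact ⟨p, q, h⟩

theorem pair_mem_setOf_pair {R : M.N → M.N → Prop} {p q : M.N} :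
    M.pair p q ∈ {n | ∃ p q, n = M.pair p q ∧ R p q} ↔ R p q := by
  constructor
  · rintro ⟨p', q', h, hR⟩
    obtain ⟨rfl, rfl⟩ := pair_inj.1 h
    exact hR
  · exact fun h => ⟨p, q, rfl, h⟩

theorem isPartialOrder_separationRel {A B : M.N → M.N → Prop}
    (hA : Bdd M (fun e => A (e 0) (e 1))) (hB : Bdd M (fun e => B (e 0) (e 1)))
    (hAB : ∀ n k k', A k n → ¬ B k' n) :
    M.IsPartialOrder Set.univ {n | ∃ p q, n = M.pair p q ∧ M.SeparationRel A B p q} where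
  mem_carrier := univ_mem
  mem_rel := setOf_pair_mem _ (bdd_separationRel hA hB)
  rel_subset := by
    rintro _ ⟨p, q, rfl, _⟩
    exact pair_mem_prod.2 ⟨trivial, trivial⟩
  refl x _ := pair_mem_setOf_pair.2 (.inl rfl)
  antisymm x _ y _ h h' :=
    separationRel_antisymm (pair_mem_setOf_pair.1 h) (pair_mem_setOf_pair.1 h')
  trans x _ y _ z _ h h' := pair_mem_setOf_pair.2
    (separationRel_trans hAB (pair_mem_setOf_pair.1 h) (pair_mem_setOf_pair.1 h'))

/-- `Σ⁰₁` separation. -/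
theorem SubsetStatement.exists_separating (h : M.SubsetStatement) (A B : M.N → M.N → Prop)
    (hAB : ∀ n k k', A k n → ¬ B k' n)
    (hA : Bdd M (fun e => A (e 0) (e 1)) := by infer_instance)
    (hB : Bdd M (fun e => B (e 0) (e 1)) := by infer_instance) :
    ∃ C ∈ M.S, ∀ n k, (A k n → n ∈ C) ∧ (B k n → n ∉ C) := by
  -- Every proper relation involves a point tagged `0`, so the points tagged `1` or `2` form an
  -- antichain, in which those tagged `1` are an initial interval.
  have hQ : {n : M.N | ∃ w t, n = M.pair w t ∧ (t = 1 ∨ t = 1 + 1)} ∈ M.S :=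
    setOf_pair_mem (fun _ t => t = 1 ∨ t = 1 + 1)
  have hI : {n : M.N | ∃ w t, n = M.pair w t ∧ t = 1} ∈ M.S := setOf_pair_mem (fun _ t => t = 1)
  have key := h _ _ _ (isPartialOrder_separationRel hA hB hAB) hQ (Set.subset_univ _)
  have hmem : {n : M.N | ∃ w t, n = M.pair w t ∧ t = 1} ∈ M.initialIntervals
      {n : M.N | ∃ w t, n = M.pair w t ∧ (t = 1 ∨ t = 1 + 1)}
      ({n | ∃ p q, n = M.pair p q ∧ M.SeparationRel A B p q} ∩
        M.prod {n : M.N | ∃ w t, n = M.pair w t ∧ (t = 1 ∨ t = 1 + 1)}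
          {n : M.N | ∃ w t, n = M.pair w t ∧ (t = 1 ∨ t = 1 + 1)}) := by
    refine ⟨hI, fun n ⟨w, t, h, ht⟩ => ⟨w, t, h, .inl ht⟩, ?_⟩
    rintro x hx y hy ⟨hxy, _⟩ hyI
    rcases pair_mem_setOf_pair.1 hxy with rfl | ⟨n, k, rfl, _⟩ | ⟨n, k, _, rfl, _⟩
    · exact hyI
    · rcases pair_mem_setOf_pair.1 hx with h | h
      exacts [(zero_ne_one h).elim, (one_add_one_ne_zero h.symm).elim]
    · exact (zero_ne_one (pair_mem_setOf_pair (R := fun _ t => t = 1).1 hyI)).elim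
  rw [key] at hmem
  obtain ⟨J, ⟨hJS, _, hJ⟩, hIJ⟩ := hmem
  have hIJ := Set.ext_iff.1 hIJ
  have : Fact (J ∈ M.S) := ⟨hJS⟩
  refine ⟨{n | M.pair n 0 ∈ J}, setOf_mem (fun n => M.pair n 0 ∈ J), fun n k => ⟨fun hk => ?_,
    fun hk hn => ?_⟩⟩
  · refine hJ _ trivial (M.pair (M.pair n k) 1) trivial
      (pair_mem_setOf_pair.2 (.inr (.inl ⟨n, k, rfl, rfl, hk⟩))) ?_
    exact ((hIJ _).1 ⟨_, 1, rfl, rfl⟩).1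
  -- If `n` were in `J`, the point tagged `2` below it would be in `J` and in the suborder, hence
  -- would be tagged `1`.
  · have hβ := hJ (M.pair (M.pair n k) (1 + 1)) trivial _ trivial
      (pair_mem_setOf_pair.2 (.inr (.inr ⟨n, k, rfl, rfl, hk⟩))) hn
    exact one_add_one_ne_one (pair_mem_setOf_pair (R := fun _ t => t = 1).1
      ((hIJ _).2 ⟨hβ, _, _, rfl, .inr rfl⟩))

/-! ### Restrictions of finite sets and recursion along a set of pairs -/

/-- `d` is the code of the set of those elements of the set coded by `c` that are below `i`. -/
def IsRestr (M : L2Structure.{u}) (i c d : M.N) : Prop :=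
  M.IsFinCode d ∧ ∀ x, x ∈ M.finSet d ↔ x ∈ M.finSet c ∧ x < i

instance Bdd.isRestr {r s t : (ℕ → M.N) → M.N} [Tm M r] [Tm M s] [Tm M t] :
    Bdd M (fun e => M.IsRestr (r e) (s e) (t e)) := by
  have h : Bdd M (fun e => M.IsFinCode (e 2) ∧
    ∀ x, x < e 1 + e 2 → (x ∈ M.finSet (e 2) ↔ x ∈ M.finSet (e 1) ∧ x < e 0)) := inferInstance
  refine (h.congr (Q := fun e => M.IsRestr (e 0) (e 1) (e 2)) fun e => and_congr_right
    fun _ => ⟨fun h x _ => h x, fun h x => ?_⟩).comp₃ (R := M.IsRestr)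
  by_cases hx : x < e 1 + e 2
  · exact h x hx
  · exact iff_of_false (fun h' => hx ((lt_of_mem_finSet h').trans_le le_add_self))
      (fun h' => hx ((lt_of_mem_finSet h'.1).trans_le le_self_add))

/-- Lowering the first component of the triple to `min k i` cuts the set at `i` without touching the
moduli. The bound `d ≤ c` keeps `IsRec` a bounded property. -/
theorem exists_isRestr (i : M.N) {c : M.N} (hc : M.IsFinCode c) :
    ∃ d, d ≤ c ∧ M.IsRestr i c d := by
  obtain ⟨k, m, n, rfl⟩ := hc.1
  obtain ⟨d, hd, hd', h⟩ := exists_isFinCode_le (M := M) ⟨min k i, m, n, rfl⟩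
  refine ⟨d, hd.trans (pair_le_pair (min_le_left _ _) le_rfl), hd', fun x => ?_⟩
  rw [h, mem_finSet_pair, mem_finSet_pair, lt_min_iff]
  tauto

theorem IsRestr.unique {i c d d' : M.N} (h : M.IsRestr i c d) (h' : M.IsRestr i c d') : d = d' :=
  h.1.eq h'.1 (Set.ext fun x => (h.2 x).trans (h'.2 x).symm)

theorem isRestr_congr {M : L2Structure.{u}} {i c c' d : M.N}
    (h : ∀ x, x < i → (x ∈ M.finSet c ↔ x ∈ M.finSet c')) :
    M.IsRestr i c d ↔ M.IsRestr i c' d :=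
  and_congr_right fun _ => forall_congr' fun x => iff_congr Iff.rfl (and_congr_left (h x))

/-- The set coded by `c` is the set of the numbers `i < n` such that `C` contains the pair of `i`
and of the code of the part below `i` of that set. -/
def IsRec (M : L2Structure.{u}) (C : Set M.N) (n c : M.N) : Prop :=
  M.IsFinCode c ∧ (∀ i ∈ M.finSet c, i < n) ∧
    ∀ i, i < n → (i ∈ M.finSet c ↔ ∃ d, M.IsRestr i c d ∧ M.pair i d ∈ C)

instance Bdd.isRec {C : Set M.N} [Fact (C ∈ M.S)] {s t : (ℕ → M.N) → M.N} [Tm M s] [Tm M t] :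
    Bdd M (fun e => M.IsRec C (s e) (t e)) := by
  have h : Bdd M (fun e => M.IsFinCode (e 1) ∧ (∀ i, i < e 1 → i ∈ M.finSet (e 1) → i < e 0) ∧
    ∀ i, i < e 0 → (i ∈ M.finSet (e 1) ↔
      ∃ d, d < e 1 + 1 ∧ M.IsRestr i (e 1) d ∧ M.pair i d ∈ C)) := inferInstance
  refine (h.congr (Q := fun e => M.IsRec C (e 0) (e 1)) fun e => and_congr_right
    fun hc => and_congr ⟨fun h i _ => h i, fun h i hi => h i (lt_of_mem_finSet hi) hi⟩
      (forall_congr' fun i => imp_congr_right fun _ => iff_congr Iff.rfl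
        ⟨fun ⟨d, hd, hdC⟩ => ⟨d, ?_, hd, hdC⟩, fun ⟨d, _, h⟩ => ⟨d, h⟩⟩)).comp₂ (R := M.IsRec C)
  obtain ⟨d', hd', h'⟩ := exists_isRestr i hc
  exact lt_add_one_iff.2 (hd.unique h' ▸ hd')

/-- Membership of `i` depends only on the part of the set below `i`, which is the same before and
after cutting at `m > i`. -/
theorem IsRec.restrict {C : Set M.N} {m n c d : M.N} (h : M.IsRec C n c) (hmn : m ≤ n)
    (hd : M.IsRestr m c d) : M.IsRec C m d := by
  refine ⟨hd.1, fun i hi => ((hd.2 i).1 hi).2, fun i hi => ?_⟩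
  rw [hd.2, and_iff_left hi, h.2.2 i (hi.trans_le hmn)]
  refine exists_congr fun e => and_congr_left fun _ => isRestr_congr fun x hx => ?_
  rw [hd.2, and_iff_left (hx.trans hi)]

theorem IsRec.unique {C : Set M.N} {n c c' : M.N} (h : M.IsRec C n c) (h' : M.IsRec C n c') :
    c = c' := by
  refine h.1.eq h'.1 (Set.ext fun i => ?_)
  by_cases hi : i < n
  · refine strong_induction (fun i => i < n → (i ∈ M.finSet c ↔ i ∈ M.finSet c'))
      (fun i ih hi => ?_) i (by infer_instance) hi
    rw [h.2.2 i hi, h'.2.2 i hi]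
    exact exists_congr fun d => and_congr_left fun _ =>
      isRestr_congr fun x hx => ih x hx (hx.trans hi)
  · exact iff_of_false (fun hc => hi (h.2.1 i hc)) (fun hc => hi (h'.2.1 i hc))

theorem exists_isRec {C : Set M.N} [Fact (C ∈ M.S)] (n : M.N) : ∃ c, M.IsRec C n c := by
  refine induction_exists (fun c n => M.IsRec C n c) ?_ (fun n ⟨c, hc⟩ => ?_) n
  · obtain ⟨U, hU⟩ := exists_codeBound (0 : M.N)
    obtain ⟨c, _, hc, h⟩ := hU.exists_isFinCode (fun i => i = i)
    exact ⟨c, hc, fun i hi => ((h i).1 hi).1, fun i hi => (not_lt_zero hi).elim⟩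
  · obtain ⟨U, hU⟩ := exists_codeBound (n + 1)
    obtain ⟨d, _, hd, h⟩ := hU.exists_isFinCode
      -- The new set keeps the old elements and asks `C` whether to add `n`.
      (fun i => i ∈ M.finSet c ∨ i = n ∧ M.pair n c ∈ C)
    have hlt : ∀ x, x < n → (x ∈ M.finSet d ↔ x ∈ M.finSet c) := by
      intro x hx
      rw [h, and_iff_right (hx.trans (lt_add_one_iff.2 le_rfl))]
      simp [hx.ne]
    refine ⟨d, hd, fun i hi => ((h i).1 hi).1, fun i hi => ?_⟩
    rcases (lt_add_one_iff.1 hi).lt_or_eq with hi | rfl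
    · rw [hlt i hi, hc.2.2 i hi]
      exact exists_congr fun e => and_congr_left fun _ =>
        isRestr_congr fun x hx => (hlt x (hx.trans hi)).symm
    · have hcd : M.IsRestr i d c := ⟨hc.1, fun x =>
        ⟨fun hx => ⟨(hlt x (hc.2.1 x hx)).2 hx, hc.2.1 x hx⟩, fun hx => (hlt x hx.2).1 hx.1⟩⟩
      rw [h, and_iff_right hi]
      constructor
      · rintro (h₁ | ⟨_, h₁⟩)
        · exact (lt_irrefl i (hc.2.1 i h₁)).elim
        · exact ⟨c, hcd, h₁⟩
      · rintro ⟨e, he, heC⟩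
        exact .inr ⟨rfl, he.unique hcd ▸ heC⟩

/-! ### Weak König's lemma from separation -/

/-- Some `s < U` in `T` of length `l` agrees below `n` with the set coded by `c`. -/
def Extendible (M : L2Structure.{u}) (T : Set M.N) (n c l U : M.N) : Prop :=
  ∃ s, s < U ∧ s ∈ T ∧ M.IsSeq l s ∧ ∀ i, i < n → (M.pair i 1 ∈ M.finSet s ↔ i ∈ M.finSet c)

/-- Some `s < U` in `T` of length `l` agrees below `n` with the set coded by `c`, and has the
value `1` at `n`. -/
def ExtendibleOne (M : L2Structure.{u}) (T : Set M.N) (n c l U : M.N) : Prop :=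
  ∃ s, s < U ∧ s ∈ T ∧ M.IsSeq l s ∧
    (∀ i, i < n → (M.pair i 1 ∈ M.finSet s ↔ i ∈ M.finSet c)) ∧ M.pair n 1 ∈ M.finSet s

/-- Some `s < U` in `T` of length `l` agrees below `n` with the set coded by `c`, and does not
have the value `1` at `n`. -/
def ExtendibleZero (M : L2Structure.{u}) (T : Set M.N) (n c l U : M.N) : Prop :=
  ∃ s, s < U ∧ s ∈ T ∧ M.IsSeq l s ∧
    (∀ i, i < n → (M.pair i 1 ∈ M.finSet s ↔ i ∈ M.finSet c)) ∧ ¬ M.pair n 1 ∈ M.finSet s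

/-- The initial segment of `s` of length `l` has a code, lies in `T` by closure, and is below `U`
like every binary sequence of that length. -/
theorem IsBinTree.exists_restrict {T : Set M.N} (hT : M.IsBinTree T) {s l l' U : M.N}
    (hs : s ∈ T) (hl' : M.IsSeq l' s) (hl : l ≤ l') (hU : M.CodeBound (M.pair l 1) U) :
    ∃ t, t < U ∧ t ∈ T ∧ M.IsSeq l t ∧
      ∀ i, i < l → (M.pair i 1 ∈ M.finSet t ↔ M.pair i 1 ∈ M.finSet s) := by
  obtain ⟨t, ht, htb, h⟩ := exists_binSeq l (fun i => M.pair i 1 ∈ M.finSet s)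
  refine ⟨t, htb.lt_of_codeBound ht hU, hT.2.2 s hs t htb fun n hn => ?_, ht, fun i hi => ?_⟩
  · obtain ⟨i, j, rfl⟩ := ht.2.1 n hn
    obtain ⟨hi, ⟨rfl, h₁⟩ | ⟨rfl, h₁⟩⟩ := (h i j).1 hn
    · exact h₁
    · exact ((hT.2.1 s hs).pair_zero_mem_iff hl' (hi.trans_le hl)).2 h₁
  · rw [h, and_iff_right hi]
    simp

theorem ExtendibleOne.mono {T : Set M.N} (hT : M.IsBinTree T) {n c l l' U U' : M.N}
    (h : M.ExtendibleOne T n c l' U') (hn : n < l) (hl : l ≤ l')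
    (hU : M.CodeBound (M.pair l 1) U) : M.ExtendibleOne T n c l U := by
  obtain ⟨s, _, hs, hl', h₁, h₂⟩ := h
  obtain ⟨t, htU, ht, htl, h⟩ := hT.exists_restrict hs hl' hl hU
  exact ⟨t, htU, ht, htl, fun i hi => (h i (hi.trans hn)).trans (h₁ i hi), (h n hn).2 h₂⟩

theorem ExtendibleZero.mono {T : Set M.N} (hT : M.IsBinTree T) {n c l l' U U' : M.N}
    (h : M.ExtendibleZero T n c l' U') (hn : n < l) (hl : l ≤ l')
    (hU : M.CodeBound (M.pair l 1) U) : M.ExtendibleZero T n c l U := by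
  obtain ⟨s, _, hs, hl', h₁, h₂⟩ := h
  obtain ⟨t, htU, ht, htl, h⟩ := hT.exists_restrict hs hl' hl hU
  exact ⟨t, htU, ht, htl, fun i hi => (h i (hi.trans hn)).trans (h₁ i hi),
    fun h' => h₂ ((h n hn).1 h')⟩

/-- There is a set of pairs deciding for each finite binary sequence in which of its two
one-step extensions `T` is at least as high as in the other. -/
theorem SubsetStatement.exists_decision (h : M.SubsetStatement) {T : Set M.N}
    (hT : M.IsBinTree T) : ∃ C ∈ M.S, ∀ n c l U, M.CodeBound (M.pair l 1) U → n < l →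
      (¬ M.ExtendibleZero T n c l U → M.ExtendibleOne T n c l U → M.pair n c ∈ C) ∧
      (¬ M.ExtendibleOne T n c l U → M.ExtendibleZero T n c l U → M.pair n c ∉ C) := by
  have : Fact (T ∈ M.S) := ⟨hT.1⟩
  obtain ⟨C, hC, hAB⟩ := h.exists_separating
    (fun k σ => ∃ n, n < σ + 1 ∧ ∃ c, c < σ + 1 ∧ ∃ l, l < k ∧ ∃ U, U < k ∧ σ = M.pair n c ∧
      M.CodeBound (M.pair l 1) U ∧ n < l ∧ ¬ M.ExtendibleZero T n c l U ∧
      M.ExtendibleOne T n c l U)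
    (fun k σ => ∃ n, n < σ + 1 ∧ ∃ c, c < σ + 1 ∧ ∃ l, l < k ∧ ∃ U, U < k ∧ σ = M.pair n c ∧
      M.CodeBound (M.pair l 1) U ∧ n < l ∧ ¬ M.ExtendibleOne T n c l U ∧
      M.ExtendibleZero T n c l U)
    (by
      rintro _ k k' ⟨n, _, c, _, l, _, U, _, rfl, hU, hnl, h₀, h₁⟩
        ⟨n', _, c', _, l', _, U', _, heq, hU', hnl', h₁', h₀'⟩
      obtain ⟨rfl, rfl⟩ := pair_inj.1 heq
      -- The extension at the higher level restricts to the lower level, where one of the two cases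
      -- says that there is none.
      rcases le_total l l' with hl | hl
      · exact h₀ (h₀'.mono hT hnl hl hU)
      · exact h₁' (h₁.mono hT hnl' hl hU'))
    (by unfold ExtendibleZero ExtendibleOne; infer_instance)
    (by unfold ExtendibleZero ExtendibleOne; infer_instance)
  refine ⟨C, hC, fun n c l U hU hnl => ⟨fun h₀ h₁ => ?_, fun h₁ h₀ => ?_⟩⟩
  -- The single witness `l + U + 1` bounds both the level and its code bound.
  · exact (hAB (M.pair n c) (l + U + 1)).1 ⟨n, lt_add_one_iff.2 (left_le_pair _ _), c,
      lt_add_one_iff.2 (right_le_pair _ _), l, lt_add_one_iff.2 le_self_add, U,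
      lt_add_one_iff.2 le_add_self, rfl, hU, hnl, h₀, h₁⟩
  · exact (hAB (M.pair n c) (l + U + 1)).2 ⟨n, lt_add_one_iff.2 (left_le_pair _ _), c,
      lt_add_one_iff.2 (right_le_pair _ _), l, lt_add_one_iff.2 le_self_add, U,
      lt_add_one_iff.2 le_add_self, rfl, hU, hnl, h₁, h₀⟩

/-- By `Π⁰₁` induction on `n`, for all levels at once. At a given level the shorter segment extends
through `0` or through `1`; if only one of these is possible, `C` chooses it. -/
theorem IsRec.extendible {T C : Set M.N} (hT : M.IsBinTree T) (hinf : M.IsInfinite T)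
    (hCS : C ∈ M.S) (hC : ∀ n c l U, M.CodeBound (M.pair l 1) U → n < l →
      (¬ M.ExtendibleZero T n c l U → M.ExtendibleOne T n c l U → M.pair n c ∈ C) ∧
      (¬ M.ExtendibleOne T n c l U → M.ExtendibleZero T n c l U → M.pair n c ∉ C))
    {n c l U : M.N} (hc : M.IsRec C n c) (hU : M.CodeBound (M.pair l 1) U) (hnl : n ≤ l) :
    M.Extendible T n c l U := by
  have : Fact (T ∈ M.S) := ⟨hT.1⟩
  have : Fact (C ∈ M.S) := ⟨hCS⟩
  -- One number `z` bounds `c`, `l` and `U`, so a single unbounded universal quantifier remains.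
  have key := induction_forall (fun z n => ∀ c, c < z → ∀ l, l < z → ∀ U, U < z →
    M.IsRec C n c → M.CodeBound (M.pair l 1) U → n ≤ l → M.Extendible T n c l U) ?_ ?_
    n (c + l + U + 1) (by unfold Extendible; infer_instance)
  · refine key c ?_ l ?_ U ?_ hc hU hnl <;> rw [lt_add_one_iff]
    exacts [le_self_add.trans le_self_add, le_add_self.trans le_self_add, le_add_self]
  · intro z c _ l _ U _ _ hU _
    -- An element of `T` above `U` has length at least `l`, because shorter binary sequences have
    -- codes below `U`.
    obtain ⟨s, hs, hUs⟩ := hinf U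
    obtain ⟨l', hl'⟩ := (hT.2.1 s hs).1
    have hl : l ≤ l' := by
      by_contra! hlt
      refine absurd (hU.lt hl'.1 fun i hi => ?_) hUs.not_gt
      exact ((hT.2.1 s hs).lt_pair hl' hi).trans (pair_lt_pair_left hlt le_rfl)
    obtain ⟨t, htU, ht, htl, _⟩ := hT.exists_restrict hs hl' hl hU
    exact ⟨t, htU, ht, htl, fun i hi => (not_lt_zero hi).elim⟩
  · intro n ih z c _ l _ U _ hc hU hnl
    have hnl' := add_one_le_iff.1 hnl
    have hn : n < n + 1 := lt_add_one_iff.2 le_rfl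
    obtain ⟨d, _, hd⟩ := exists_isRestr n hc.1
    have hext : M.Extendible T n d l U := by
      refine ih (d + l + U + 1) d ?_ l ?_ U ?_ (hc.restrict hn.le hd) hU hnl'.le <;>
        rw [lt_add_one_iff]
      exacts [le_self_add.trans le_self_add, le_add_self.trans le_self_add, le_add_self]
    have hval : n ∈ M.finSet c ↔ M.pair n d ∈ C := by
      rw [hc.2.2 n hn]
      exact ⟨fun ⟨e, he, heC⟩ => he.unique hd ▸ heC, fun h => ⟨d, hd, h⟩⟩
    have hdc : ∀ i, i < n → (i ∈ M.finSet d ↔ i ∈ M.finSet c) := fun i hi => by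
      rw [hd.2, and_iff_left hi]
    obtain ⟨s, hsU, hs, hsl, hsd⟩ := hext
    by_cases hnc : n ∈ M.finSet c
    · have h₁ : M.ExtendibleOne T n d l U := by
        by_contra h₁
        refine (hC n d l U hU hnl').2 h₁ ⟨s, hsU, hs, hsl, hsd, fun h => ?_⟩ (hval.1 hnc)
        exact h₁ ⟨s, hsU, hs, hsl, hsd, h⟩
      obtain ⟨t, htU, ht, htl, htd, htn⟩ := h₁
      refine ⟨t, htU, ht, htl, fun i hi => ?_⟩
      rcases (lt_add_one_iff.1 hi).lt_or_eq with hi | rfl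
      exacts [(htd i hi).trans (hdc i hi), iff_of_true htn hnc]
    · have h₀ : M.ExtendibleZero T n d l U := by
        by_contra h₀
        refine hnc (hval.2 ((hC n d l U hU hnl').1 h₀ ⟨s, hsU, hs, hsl, hsd, ?_⟩))
        by_contra h
        exact h₀ ⟨s, hsU, hs, hsl, hsd, h⟩
      obtain ⟨t, htU, ht, htl, htd, htn⟩ := h₀
      refine ⟨t, htU, ht, htl, fun i hi => ?_⟩
      rcases (lt_add_one_iff.1 hi).lt_or_eq with hi | rfl
      exacts [(htd i hi).trans (hdc i hi), iff_of_false htn hnc]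

/-- The set obtained by recursion along `C`. -/
theorem exists_recursive_set {C : Set M.N} (hC : C ∈ M.S) :
    ∃ X ∈ M.S, ∀ n c, M.IsRec C n c → ∀ i, i < n → (i ∈ M.finSet c ↔ i ∈ X) := by
  have : Fact (C ∈ M.S) := ⟨hC⟩
  -- Existence and uniqueness of the stage of length `i + 1` make membership `Δ⁰₁`.
  refine ⟨_, setOf_exists_mem (fun c i => M.IsRec C (i + 1) c ∧ i ∈ M.finSet c)
    (fun c i => M.IsRec C (i + 1) c → i ∈ M.finSet c) fun i => ⟨?_, fun h => ?_⟩,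
    fun n c hc i hi => ?_⟩
  · rintro ⟨c, hc, hi⟩ d hd
    exact hd.unique hc ▸ hi
  · obtain ⟨c, hc⟩ := exists_isRec (C := C) (i + 1)
    exact ⟨c, hc, h c hc⟩
  · obtain ⟨d, _, hd⟩ := exists_isRestr (i + 1) hc.1
    have hdr := hc.restrict (add_one_le_iff.2 hi) hd
    have hid : i ∈ M.finSet d ↔ i ∈ M.finSet c := by
      rw [hd.2, and_iff_left (lt_add_one_iff.2 le_rfl)]
    rw [← hid]
    exact ⟨fun h => ⟨d, hdr, h⟩, fun ⟨e, he, hie⟩ => hdr.unique he ▸ hie⟩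

theorem weakKonig_of_subsetStatement (h : M.SubsetStatement) : M.WeakKonig := by
  intro T hT hinf
  obtain ⟨C, hCS, hC⟩ := h.exists_decision hT
  have : Fact (C ∈ M.S) := ⟨hCS⟩
  obtain ⟨X, hXS, hX⟩ := exists_recursive_set hCS
  have : Fact (X ∈ M.S) := ⟨hXS⟩
  refine ⟨_, ⟨setOf_pair_mem (fun i j => j = 1 ∧ i ∈ X ∨ j = 0 ∧ ¬ i ∈ X), ?_, fun i _ => ?_⟩,
    fun n => ?_⟩
  · rintro _ ⟨i, j, rfl, _⟩
    exact pair_mem_prod.2 ⟨trivial, trivial⟩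
  · simp only [pair_mem_setOf_pair]
    by_cases hi : i ∈ X
    · exact ⟨1, .inl ⟨rfl, hi⟩, fun j hj => by simpa [hi] using hj⟩
    · exact ⟨0, .inr ⟨rfl, hi⟩, fun j hj => by simpa [hi] using hj⟩
  · obtain ⟨c, hc⟩ := exists_isRec (C := C) n
    obtain ⟨U, hU⟩ := exists_codeBound (M.pair n 1)
    obtain ⟨s, _, hs, hsl, hsc⟩ := hc.extendible hT hinf hCS hC hU le_rfl
    refine ⟨s, hs, hsl, fun i hi j => ?_⟩
    have hb := hT.2.1 s hs
    have h1 : M.pair i 1 ∈ M.finSet s ↔ i ∈ X := (hsc i hi).trans (hX n c hc i hi)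
    rw [pair_mem_setOf_pair]
    constructor
    · intro hj
      rcases hb.2 i j hj with rfl | rfl
      · exact .inr ⟨rfl, fun hi' => (hb.pair_zero_mem_iff hsl hi).1 hj (h1.2 hi')⟩
      · exact .inl ⟨rfl, h1.1 hj⟩
    · rintro (⟨rfl, hi'⟩ | ⟨rfl, hi'⟩)
      · exact h1.2 hi'
      · exact (hb.pair_zero_mem_iff hsl hi).2 fun h => hi' (h1.1 h)

end L2Structure

/-- Over RCA₀, that is, in every model of RCA₀, the following are equivalent: WKL₀, the statement
about embeddings of partial orders, and the statement about subsets of partial orders. -/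
theorem lemma5p8 (M : L2Structure.{u}) (hM : M.ModelsRCA0) :
    [M.ModelsWKL0, M.EmbeddingStatement, M.SubsetStatement].TFAE := by
  have : Fact M.ModelsRCA0 := ⟨hM⟩
  tfae_have 1 → 2 := fun h => L2Structure.embeddingStatement_of_weakKonig h.2
  tfae_have 2 → 3 := L2Structure.subsetStatement_of_embeddingStatement
  tfae_have 3 → 1 := fun h => ⟨hM, L2Structure.weakKonig_of_subsetStatement h⟩
  tfae_finish
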